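/- Let $X$ be a complex Banach space, let $-A$ be the generator of a $C_0$-semigroup $(e^{-tA})_{t\ge 0}$ on $X$ with $M:=\sup_{t\ge 0}\|e^{-tA}\|<\infty$, and assume that the range of $A$ is dense in $X$. For $n\in\mathbb N$, $n\ge 1$, and $t>0$ put $$\Delta_{n,t}(A):=\Bigl(1+\tfrac tn A\Bigr)^{-n}-e^{-tA},$$ where the inverse of $1+hA$ exists as a bounded operator on $X$ for every $h>0$. *Functional calculus.* For a bounded complex Radon measure $\mu$ on $[0,\infty)$ let $(\mathcal L\mu)(z)=\int_0^\infty e^{-sz}\,\mu(ds)$ for $\operatorname{Re}z>0$, and let $(\mathcal L\mu)(A)x=\int_0^\infty e^{-sA}x\,\mu(ds)$ for $x\in X$. A holomorphic function $f$ on $\mathbb C_+=\{\operatorname{Re} z>0\}$ is regularizable if there is a function $e=\mathcal L\nu$ with $e(A)$ injective and $ef=\mathcal L\rho$ on $\mathbb C_+$, for some bounded complex Radon measures $\nu,\rho$ on $[0,\infty)$; then $f(A):=e(A)^{-1}(ef)(A)$, with domain $\{x\in X:(ef)(A)x\in\operatorname{ran} e(A)\}$ (this does not depend on $e$). For $\alpha>0$,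 $A^\alpha$ denotes $f(A)$ for $f(z)=z^\alpha$ (principal branch). *The class $\mathcal S_2$.* It consists of the functions $f:(0,\infty)\to[0,\infty)$ of the form $f(z)=a+\int_{[0,\infty)}\frac{\mu(d\tau)}{(z+\tau)^2}$, where $a\ge 0$ and $\mu$ is a positive Radon measure on $[0,\infty)$ with $\int_{[0,\infty)}\frac{\mu(d\tau)}{(1+\tau)^2}<\infty$. Each such $f$ has a unique holomorphic extension to $\mathbb C\setminus(-\infty,0]$, also denoted by $f$. Then every $f\in\mathcal S_2$ is regularizable, and for all integers $n\ge 1$ and all $t>0$ the following hold. 1. For every $x\in X$, $\Delta_{n,t}(A)x\in\operatorname{dom}(f(A))$ and $$\|f(A)\Delta_{n,t}(A)x\|\le 12M\,f(\sqrt n/t)\,\|x\|.$$ 2. For every $y\in\operatorname{dom}(f(A))$, $$\|\Delta_{n,t}(A)f(A)y\|\le 12M\,f(\sqrt n/t)\,\|y\|.$$ In particular, for every $\alpha\in(0,2]$ the function $z^\alpha$ is regularizable, and for all $x\in\operatorname{dom}(A^\alpha)$, all integers $n\ge1$ and all $t>0$, $$\|\Delta_{n,t}(A)x\|\le 12M\Bigl(\frac{t}{\sqrt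 n}\Bigr)^{\alpha}\|A^\alpha x\|.$$ -/

import Mathlib

open MeasureTheory Filter Topology
open scoped NNReal

namespace EulerApprox

/-! ### Bounded complex measures on `[0, ∞)` and their Laplace transforms -/

section Measures

variable {E : Type*} [NormedAddCommGroup E] [NormedSpace ℂ E]

/-- The total variation of a complex measure is finite. -/
theorem isFiniteMeasure_variation {α : Type*} [MeasurableSpace α] (μ : ComplexMeasure α) :
    IsFiniteMeasure μ.variation := by
  set m : Measure α := (ComplexMeasure.re μ).totalVariation + (ComplexMeasure.im μ).totalVariation
  have hle : μ.variation ≤ m := by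
    refine VectorMeasure.variation_le_of_forall_enorm_le fun s _ => ?_
    have h1 : ‖μ s‖ₑ ≤ ‖(ComplexMeasure.re μ) s‖ₑ + ‖(ComplexMeasure.im μ) s‖ₑ := by
      have h : ‖μ s‖₊ ≤ ‖(μ s).re‖₊ + ‖(μ s).im‖₊ := Complex.norm_le_abs_re_add_abs_im (μ s)
      have h' : ‖μ s‖ₑ ≤ ‖(μ s).re‖ₑ + ‖(μ s).im‖ₑ := by
        simp only [enorm_eq_nnnorm]
        exact_mod_cast h
      exact h'
    refine h1.trans ?_
    rw [Measure.add_apply, SignedMeasure.totalVariation_eq_variation,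
      SignedMeasure.totalVariation_eq_variation]
    exact add_le_add (VectorMeasure.enorm_measure_le_variation _ _)
      (VectorMeasure.enorm_measure_le_variation _ _)
  have hfin : IsFiniteMeasure m := by
    have : IsFiniteMeasure (ComplexMeasure.re μ).totalVariation := by
      unfold SignedMeasure.totalVariation; infer_instance
    have : IsFiniteMeasure (ComplexMeasure.im μ).totalVariation := by
      unfold SignedMeasure.totalVariation; infer_instance
    infer_instance
  exact ⟨(hle _).trans_lt (measure_lt_top m _)⟩

/-- `∫ g(s) μ(ds)` for a vector-valued `g` and a complex measure `μ` on `[0, ∞)`. -/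
noncomputable def cintegral (μ : ComplexMeasure ℝ≥0) (g : ℝ≥0 → E) : E :=
  μ.integral g (ContinuousLinearMap.lsmul ℝ ℂ).flip

/-- The Laplace transform `(ℒμ)(z) = ∫ e^{-sz} μ(ds)`; it is used for `Re z > 0`. -/
noncomputable def laplace (μ : ComplexMeasure ℝ≥0) (z : ℂ) : ℂ :=
  cintegral μ fun s => Complex.exp (-((s : ℝ) : ℂ) * z)

end Measures

/-! ### Bounded `C₀`-semigroups and their generators -/

/-- A bounded `C₀`-semigroup `(T(t))_{t ≥ 0}` on `X`. -/
structure BoundedC0Semigroup (X : Type*) [NormedAddCommGroup X] [NormedSpace ℂ X] where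
  /-- the operators of the semigroup -/
  T : ℝ≥0 → X →L[ℂ] X
  map_zero : T 0 = 1
  map_add : ∀ s t, T (s + t) = T s * T t
  continuous_orbit : ∀ x, Continuous fun t => T t x
  bounded : ∃ C : ℝ, ∀ t, ‖T t‖ ≤ C

namespace BoundedC0Semigroup

variable {X : Type*} [NormedAddCommGroup X] [NormedSpace ℂ X] (S : BoundedC0Semigroup X)

/-- `y` is the right derivative at `0` of the orbit `t ↦ T(t)x`. -/
def HasOrbitDeriv (x y : X) : Prop :=
  Tendsto (fun h : ℝ≥0 => ((h : ℂ)⁻¹) • (S.T h x - x)) (𝓝[>] 0) (𝓝 y)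

/-- The generator of the semigroup, an unbounded operator: `x ↦ lim_{h → 0+} (T(h)x - x) / h`,
with domain the set of all `x` for which the limit exists. -/
noncomputable def generator : X →ₗ.[ℂ] X where
  domain :=
    { carrier := {x | ∃ y, S.HasOrbitDeriv x y}
      add_mem' := by
        rintro a b ⟨y, hy⟩ ⟨z, hz⟩
        refine ⟨y + z, (hy.add hz).congr fun h => ?_⟩
        rw [← smul_add, _root_.map_add]; congr 1; abel
      zero_mem' := ⟨0, by simp [HasOrbitDeriv]⟩
      smul_mem' := by
        rintro c a ⟨y, hy⟩
        refine ⟨c • y, (hy.const_smul c).congr fun h => ?_⟩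
        rw [map_smul, ← smul_sub, smul_comm] }
  toFun :=
    { toFun := fun x => x.2.choose
      map_add' := by
        intro a b
        refine tendsto_nhds_unique (a + b).2.choose_spec ?_
        refine (a.2.choose_spec.add b.2.choose_spec).congr fun h => ?_
        rw [← smul_add, Submodule.coe_add, _root_.map_add]; congr 1; abel
      map_smul' := by
        intro c a
        refine tendsto_nhds_unique (c • a).2.choose_spec ?_
        refine (a.2.choose_spec.const_smul c).congr fun h => ?_
        rw [Submodule.coe_smul, map_smul, ← smul_sub, smul_comm] }

/-! ### The (extended) Hille-Phillips calculus -/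

theorem integrable_orbit (μ : ComplexMeasure ℝ≥0) (x : X) :
    μ.Integrable fun s => S.T s x := by
  have := isFiniteMeasure_variation μ
  obtain ⟨C, hC⟩ := S.bounded
  refine Integrable.of_bound (S.continuous_orbit x).aestronglyMeasurable (C * ‖x‖)
    (Eventually.of_forall fun s => ?_)
  exact (S.T s).le_of_opNorm_le (hC s) x

/-- The Hille-Phillips calculus `H(ℒμ)x = ∫ T(s)x μ(ds)`, a bounded operator on `X`. -/
noncomputable def hp (μ : ComplexMeasure ℝ≥0) : X →L[ℂ] X :=
  LinearMap.mkContinuousOfExistsBound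
    { toFun := fun x => cintegral μ fun s => S.T s x
      map_add' := by
        intro x y
        simp only [cintegral, _root_.map_add]
        exact VectorMeasure.integral_fun_add (S.integrable_orbit μ x) (S.integrable_orbit μ y)
      map_smul' := by
        intro c x
        simp only [cintegral, map_smul, RingHom.id_apply]
        exact setToFun_smul _ (fun c s x => smul_comm (μ s) c x) c _ }
    (by
      have := isFiniteMeasure_variation μ
      obtain ⟨C, hC⟩ := S.bounded
      set B : X →L[ℝ] ℂ →L[ℝ] X := (ContinuousLinearMap.lsmul ℝ ℂ).flip
      refine ⟨C * ‖B‖ * μ.variation.real Set.univ, fun x => ?_⟩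
      have h : ‖μ.integral (fun s => S.T s x) B‖ ≤ (C * ‖x‖) * ‖B‖ * μ.variation.real Set.univ :=
        VectorMeasure.norm_integral_le_of_norm_le_const
          (Eventually.of_forall fun s => (S.T s).le_of_opNorm_le (hC s) x)
      calc _ ≤ (C * ‖x‖) * ‖B‖ * μ.variation.real Set.univ := h
        _ = _ := by ring)

/-- `f` is regularized by `e = ℒν` with `ef = ℒρ`: `f` is holomorphic on the open right half-plane,
`e f = ℒρ` there, and the operator `e(A) = H(ℒν)` is injective. -/
structure IsRegularizedBy (f : ℂ → ℂ) (ν ρ : ComplexMeasure ℝ≥0) : Prop where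
  holomorphic : DifferentiableOn ℂ f {z | 0 < z.re}
  mul_eq : ∀ z : ℂ, 0 < z.re → laplace ν z * f z = laplace ρ z
  injective : Function.Injective (S.hp ν)

/-- `f` belongs to the extended Hille-Phillips calculus. -/
def Regularizable (f : ℂ → ℂ) : Prop :=
  ∃ p : ComplexMeasure ℝ≥0 × ComplexMeasure ℝ≥0, S.IsRegularizedBy f p.1 p.2

/-- For bounded `P`, `Q` with `P` injective, the operator `P⁻¹ Q`, with domain
`{x | Q x ∈ ran P}`. -/
noncomputable def invComp (P Q : X →L[ℂ] X) (hP : Function.Injective P) : X →ₗ.[ℂ] X where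
  domain := (LinearMap.range (P : X →ₗ[ℂ] X)).comap (Q : X →ₗ[ℂ] X)
  toFun :=
    (LinearEquiv.ofInjective (P : X →ₗ[ℂ] X) hP).symm.toLinearMap ∘ₗ
      ((Q : X →ₗ[ℂ] X).restrict fun _ hx => hx)

open Classical in
/-- The extended Hille-Phillips calculus: the operator `f(A) = e(A)⁻¹ (ef)(A)`, where `e` is a
regularizer of `f` (the operator does not depend on its choice) and `-A` is the generator of the
semigroup. It is meaningful for regularizable `f` only. -/
noncomputable def calculus (f : ℂ → ℂ) : X →ₗ.[ℂ] X :=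
  if h : S.Regularizable f then
    invComp (S.hp h.choose.1) (S.hp h.choose.2) h.choose_spec.injective
  else ⊥

/-- The fractional power `A^α`, i.e. `f(A)` for `f(z) = z^α` (principal branch). -/
noncomputable def fracPow (α : ℝ) : X →ₗ.[ℂ] X :=
  S.calculus fun z => z ^ (α : ℂ)

end BoundedC0Semigroup

/-! ### Euler's approximation -/

section Euler

variable {X : Type*} [NormedAddCommGroup X] [NormedSpace ℂ X]

/-- The bounded operator `R` is the two-sided inverse `(1 + hA)⁻¹` of `1 + hA : dom A → X`. -/
def IsResolventStep (A : X →ₗ.[ℂ] X) (h : ℝ) (R : X →L[ℂ] X) : Prop :=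
  (∀ x : X, ∃ hx : R x ∈ A.domain, R x + (h : ℂ) • A ⟨R x, hx⟩ = x) ∧
    ∀ x : A.domain, R ((x : X) + (h : ℂ) • A x) = x

open Classical in
/-- The bounded operator `(1 + hA)⁻¹` (with value `0` if `1 + hA` has no bounded inverse). -/
noncomputable def resolventStep (A : X →ₗ.[ℂ] X) (h : ℝ) : X →L[ℂ] X :=
  if hR : ∃ R, IsResolventStep A h R then hR.choose else 0

/-- `Δ_{n,t}(A) = (1 + (t/n) A)⁻ⁿ - e^{-tA}`, where `e^{-tA} = T(t)`. -/
noncomputable def eulerError (S : BoundedC0Semigroup X) (A : X →ₗ.[ℂ] X) (n : ℕ) (t : ℝ≥0) :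
    X →L[ℂ] X :=
  resolventStep A ((t : ℝ) / n) ^ n - S.T t

end Euler

/-! ### Generalized Stieltjes functions -/

/-- `f : (0, ∞) → [0, ∞)` is a generalized Stieltjes function of order `α`. Only the values of `f`
on `(0, ∞)` matter. The integrability condition makes `μ` finite on compact sets, so that `μ` is a
Radon measure on `[0, ∞)`. -/
def IsGenStieltjes (α : ℝ) (f : ℝ → ℝ) : Prop :=
  ∃ (a : ℝ) (μ : Measure ℝ≥0), 0 ≤ a ∧
    Integrable (fun τ : ℝ≥0 => 1 / (1 + (τ : ℝ)) ^ α) μ ∧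
    ∀ z : ℝ, 0 < z → f z = a + ∫ τ : ℝ≥0, 1 / (z + (τ : ℝ)) ^ α ∂μ

/-- `F` is a (the) holomorphic extension of `f : (0, ∞) → ℝ` to `ℂ ∖ (-∞, 0]`. -/
def IsHolomorphicExtension (f : ℝ → ℝ) (F : ℂ → ℂ) : Prop :=
  DifferentiableOn ℂ F Complex.slitPlane ∧ ∀ x : ℝ, 0 < x → F x = f x

end EulerApprox

/-! Write `h = t / n`, `b = √n / t` and `H(z) = (1 + hz)⁻ⁿ - e^{-nhz}`, the symbol of `Δ_{n,t}(A)`.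
Two facts about `H` carry everything. It is the Laplace transform of a measure of mass at most `2`.
And `H(z) / z²` is one of mass at most `n h² = 1 / b²`: for a single step the quotient has density
`h e^{-s/h} - (h - s)₊ ≥ 0`, and `aⁿ - bⁿ = (∑ aⁱ bⁿ⁻¹⁻ⁱ)(a - b)` turns one step into `n`
(`step_div_sq`, `euler_div_sq`).

These interpolate to a mass of at most `12 / (b + τ)²` for `H(z) / (z + τ)²`, for every `τ ≥ 0`
(`div_add_sq`): small `τ` uses the second fact and the factor `(z / (z + τ))²`, large `τ` uses the
first and the factor `(τ / (z + τ))²`. Integrating against the Stieltjes measure of `f`, and adding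
`a H`, shows that `H f` is a Laplace transform of mass at most `12 f(b)` (`exists_laplace_mul`). Its
operator then has norm at most `12 M f(b)`.

To pass from symbols to operators, the Laplace transform is shown to be injective
(`eq_of_laplace_eq`) and the calculus multiplicative (`HasSymbol.mul`), so an identity of symbols is
an identity of bounded operators. Cancelling an injective regularizer extends this to the unbounded
`f(A)` (`HasSymbol.calculus_apply`). The same interpolation with `H = (z / (1 + z))²` shows that `f`
is regularizable; dense range makes that regularizer injective.

For powers, `f(z) = z^{-α}` belongs to the class, and `Δ = B A^α` on `dom A^α`, where `B` is the
bounded operator with symbol `H(z) z^{-α}`. -/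

namespace EulerApprox

/-! ### Complex measures as images of densities -/

section Presentation

variable {Ω : Type*} [MeasurableSpace Ω]

/-- The complex measure `μ` is the image of the measure with density `w` with respect to `m` under
the map `Y`. -/
structure IsPresentedBy (μ : ComplexMeasure ℝ≥0) (m : Measure Ω) (w : Ω → ℂ) (Y : Ω → ℝ≥0) :
    Prop where
  integrable : Integrable w m
  measurable : Measurable Y
  apply_eq : ∀ s, MeasurableSet s → μ s = ∫ ω in Y ⁻¹' s, w ω ∂m

theorem exists_isPresentedBy {m : Measure Ω} {w : Ω → ℂ} {Y : Ω → ℝ≥0} (hw : Integrable w m)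
    (hY : Measurable Y) : ∃ μ : ComplexMeasure ℝ≥0, IsPresentedBy μ m w Y :=
  ⟨(m.withDensityᵥ w).map Y, hw, hY, fun s hs => by
    rw [VectorMeasure.map_apply _ hY hs, withDensityᵥ_apply hw (hY hs)]⟩

/-- Radon–Nikodym, applied to the real and imaginary parts with respect to the sum of their total
variations. Integrals against a complex measure thereby become Bochner integrals, to which Fubini
applies. -/
theorem exists_presentation (μ : ComplexMeasure ℝ≥0) :
    ∃ (m : Measure ℝ≥0) (w : ℝ≥0 → ℂ), IsFiniteMeasure m ∧ IsPresentedBy μ m w id := by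
  set m : Measure ℝ≥0 :=
    (ComplexMeasure.re μ).totalVariation + (ComplexMeasure.im μ).totalVariation
  have h1 : IsFiniteMeasure (ComplexMeasure.re μ).totalVariation := by
    unfold SignedMeasure.totalVariation; infer_instance
  have h2 : IsFiniteMeasure (ComplexMeasure.im μ).totalVariation := by
    unfold SignedMeasure.totalVariation; infer_instance
  have hm : IsFiniteMeasure m := by infer_instance
  have hac : ∀ s : SignedMeasure ℝ≥0, s.totalVariation ≤ m →
      m.withDensityᵥ (s.rnDeriv m) = s := by
    intro s hs
    apply SignedMeasure.withDensityᵥ_rnDeriv_eq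
    rw [SignedMeasure.absolutelyContinuous_ennreal_iff]
    have : m.toENNRealVectorMeasure.ennrealToMeasure = m :=
      VectorMeasure.equivMeasure.right_inv m
    rw [this]
    exact Measure.absolutelyContinuous_of_le hs
  have hre := hac (ComplexMeasure.re μ) (Measure.le_add_right le_rfl)
  have him := hac (ComplexMeasure.im μ) (Measure.le_add_left le_rfl)
  set u := (ComplexMeasure.re μ).rnDeriv m
  set v := (ComplexMeasure.im μ).rnDeriv m
  have hu : Integrable u m := SignedMeasure.integrable_rnDeriv _ _
  have hv : Integrable v m := SignedMeasure.integrable_rnDeriv _ _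
  refine ⟨m, fun s => (u s : ℂ) + (v s : ℂ) * Complex.I, hm,
    hu.ofReal.add (hv.ofReal.mul_const _), measurable_id, fun s hs => ?_⟩
  have h3 : (μ s).re = ∫ x in s, u x ∂m := by
    rw [← withDensityᵥ_apply hu hs, hre]; rfl
  have h4 : (μ s).im = ∫ x in s, v x ∂m := by
    rw [← withDensityᵥ_apply hv hs, him]; rfl
  have h5 : ∫ x in s, ((u x : ℂ) + (v x : ℂ) * Complex.I) ∂m
      = ∫ x in s, (u x : ℂ) ∂m + ∫ x in s, (v x : ℂ) * Complex.I ∂m :=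
    integral_add (hu.ofReal.mono_measure Measure.restrict_le_self)
      ((hv.ofReal.mul_const _).mono_measure Measure.restrict_le_self)
  rw [Set.preimage_id, h5, integral_mul_const, integral_complex_ofReal, integral_complex_ofReal,
    ← h3, ← h4, Complex.re_add_im]

variable {E : Type*} [NormedAddCommGroup E] [NormedSpace ℂ E]

omit [NormedSpace ℂ E] in
theorem integrable_of_bound (μ : ComplexMeasure ℝ≥0) {g : ℝ≥0 → E} (hg : Continuous g) {C : ℝ}
    (hC : ∀ s, ‖g s‖ ≤ C) : μ.Integrable g := by
  have := isFiniteMeasure_variation μ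
  exact Integrable.of_bound hg.aestronglyMeasurable C (Eventually.of_forall hC)

theorem IsPresentedBy.cintegral_simpleFunc [CompleteSpace E] {μ : ComplexMeasure ℝ≥0}
    {m : Measure Ω} {w : Ω → ℂ} {Y : Ω → ℝ≥0} (h : IsPresentedBy μ m w Y)
    (f : SimpleFunc ℝ≥0 E) :
    cintegral μ f = ∫ ω, w ω • f (Y ω) ∂m := by
  have := isFiniteMeasure_variation μ
  have hint : ∀ f : SimpleFunc ℝ≥0 E, Integrable (fun ω => w ω • f (Y ω)) m := by
    intro f
    obtain ⟨C, hC⟩ := f.exists_forall_norm_le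
    exact h.integrable.smul_bdd C
      (f.stronglyMeasurable.comp_measurable h.measurable).aestronglyMeasurable
      (Eventually.of_forall fun ω => hC _)
  have hint' : ∀ f : SimpleFunc ℝ≥0 E, μ.Integrable f := by
    intro f
    obtain ⟨C, hC⟩ := f.exists_forall_norm_le
    exact Integrable.of_bound f.stronglyMeasurable.aestronglyMeasurable C
      (Eventually.of_forall fun ω => hC _)
  induction f using SimpleFunc.induction with
  | const c hs =>
    rename_i s
    have h1 : cintegral μ (s.indicator fun _ => c) = μ s • c := by
      unfold cintegral VectorMeasure.integral
      rw [setToFun_indicator_const _ hs (measure_ne_top _ _)]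
      rfl
    have h2 : ∀ ω, w ω • s.indicator (fun _ => c) (Y ω)
        = (Y ⁻¹' s).indicator (fun ω => w ω • c) ω := by
      intro ω
      by_cases hω : Y ω ∈ s <;> simp [hω]
    have h3 : (⇑(SimpleFunc.piecewise s hs (SimpleFunc.const ℝ≥0 c) (SimpleFunc.const ℝ≥0 0)))
        = s.indicator fun _ => c := by
      ext x; by_cases hx : x ∈ s <;> simp [hx]
    rw [h3, h1]
    simp only [h2]
    rw [integral_indicator (h.measurable hs), integral_smul_const, h.apply_eq s hs]
  | add hd hf hg =>
    rename_i f g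
    have h1 : cintegral μ (⇑f + ⇑g) = cintegral μ f + cintegral μ g :=
      VectorMeasure.integral_add (hint' f) (hint' g)
    rw [SimpleFunc.coe_add, h1, hf, hg, ← integral_add (hint f) (hint g)]
    simp [smul_add]

/-- Approximation by simple functions bounded by the same `C`; dominated convergence holds on both
sides. -/
theorem IsPresentedBy.cintegral_eq [CompleteSpace E] {μ : ComplexMeasure ℝ≥0}
    {m : Measure Ω} {w : Ω → ℂ} {Y : Ω → ℝ≥0} (h : IsPresentedBy μ m w Y)
    {g : ℝ≥0 → E} (hg : Continuous g) {C : ℝ} (hC : ∀ s, ‖g s‖ ≤ C) :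
    cintegral μ g = ∫ ω, w ω • g (Y ω) ∂m := by
  have := isFiniteMeasure_variation μ
  have hg' : StronglyMeasurable g := hg.stronglyMeasurable
  have hC0 : 0 ≤ C := (norm_nonneg _).trans (hC 0)
  set a := hg'.approxBounded C
  have ha : ∀ n x, ‖a n x‖ ≤ C := fun n x => hg'.norm_approxBounded_le hC0 n x
  have hlim : ∀ x, Tendsto (fun n => a n x) atTop (𝓝 (g x)) := fun x =>
    hg'.tendsto_approxBounded_of_norm_le (hC x)
  have h1 : Tendsto (fun n => cintegral μ (a n)) atTop (𝓝 (cintegral μ g)) :=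
    VectorMeasure.tendsto_integral_of_dominated_convergence (fun _ => C)
      (fun n => (a n).stronglyMeasurable.aestronglyMeasurable)
      (integrable_const _)
      (fun n => Eventually.of_forall (ha n)) (Eventually.of_forall hlim)
  have h2 : Tendsto (fun n => ∫ ω, w ω • a n (Y ω) ∂m) atTop (𝓝 (∫ ω, w ω • g (Y ω) ∂m)) := by
    refine tendsto_integral_of_dominated_convergence (fun ω => ‖w ω‖ * C) (fun n => ?_)
      (h.integrable.norm.mul_const C) (fun n => Eventually.of_forall fun ω => ?_)
      (Eventually.of_forall fun ω => (hlim _).const_smul _)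
    · exact h.integrable.aestronglyMeasurable.smul
        ((a n).stronglyMeasurable.comp_measurable h.measurable).aestronglyMeasurable
    · rw [norm_smul]
      exact mul_le_mul_of_nonneg_left (ha _ _) (norm_nonneg _)
  refine tendsto_nhds_unique h1 (h2.congr fun n => ?_)
  rw [h.cintegral_simpleFunc]

end Presentation

/-! ### Laplace transforms -/

theorem norm_exp_neg_mul_le (s : ℝ≥0) {z : ℂ} (hz : 0 < z.re) :
    ‖Complex.exp (-((s : ℝ) : ℂ) * z)‖ ≤ 1 := by
  rw [Complex.norm_exp, ← Complex.ofReal_neg, Complex.re_ofReal_mul]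
  exact Real.exp_le_one_iff.2 (by nlinarith [s.2, s.coe_nonneg])

theorem continuous_exp_neg_mul (z : ℂ) :
    Continuous fun s : ℝ≥0 => Complex.exp (-((s : ℝ) : ℂ) * z) := by fun_prop

theorem IsPresentedBy.laplace_eq {Ω : Type*} [MeasurableSpace Ω] {μ : ComplexMeasure ℝ≥0}
    {m : Measure Ω} {w : Ω → ℂ} {Y : Ω → ℝ≥0} (h : IsPresentedBy μ m w Y) {z : ℂ}
    (hz : 0 < z.re) :
    laplace μ z = ∫ ω, w ω * Complex.exp (-((Y ω : ℝ) : ℂ) * z) ∂m :=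
  h.cintegral_eq (continuous_exp_neg_mul z) fun s => norm_exp_neg_mul_le s hz

theorem laplace_sub (μ ν : ComplexMeasure ℝ≥0) {z : ℂ} (hz : 0 < z.re) :
    laplace (μ - ν) z = laplace μ z - laplace ν z :=
  VectorMeasure.integral_sub_vectorMeasure
    (integrable_of_bound μ (continuous_exp_neg_mul z) fun s => norm_exp_neg_mul_le s hz)
    (integrable_of_bound ν (continuous_exp_neg_mul z) fun s => norm_exp_neg_mul_le s hz)

/-- A finite positive measure on `[0, ∞)` is determined by its Laplace transform on `(0, ∞)`. -/
theorem measure_ext_of_laplace {p q : Measure ℝ≥0} [IsFiniteMeasure p] [IsFiniteMeasure q]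
    (h : ∀ z : ℝ, 0 < z → ∫ s, Real.exp (-(s : ℝ) * z) ∂p = ∫ s, Real.exp (-(s : ℝ) * z) ∂q) :
    p = q := by
  have hbd : ∀ (z : ℝ) (s : ℝ≥0), 0 ≤ z → ‖Real.exp (-(s : ℝ) * z)‖ ≤ 1 := by
    intro z s hz
    rw [Real.norm_eq_abs, Real.abs_exp]
    exact Real.exp_le_one_iff.2 (by nlinarith [s.coe_nonneg])
  -- The hypothesis covers only `z > 0`; equality of total masses, the case `k = 0` below, is
  -- recovered as `z → 0+`.
  have hlim : ∀ (r : Measure ℝ≥0) [IsFiniteMeasure r],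
      Tendsto (fun n : ℕ => ∫ s, Real.exp (-(s : ℝ) * (1 / ((n : ℝ) + 1))) ∂r) atTop
        (𝓝 (∫ _, (1 : ℝ) ∂r)) := by
    intro r _
    refine tendsto_integral_of_dominated_convergence (fun _ => 1) (fun n => ?_)
      (integrable_const _) (fun n => Eventually.of_forall fun s => hbd _ s (by positivity))
      (Eventually.of_forall fun s => ?_)
    · exact (by fun_prop : Continuous fun s : ℝ≥0 =>
        Real.exp (-(s : ℝ) * (1 / ((n : ℝ) + 1)))).aestronglyMeasurable
    · have := (tendsto_one_div_add_atTop_nhds_zero_nat (𝕜 := ℝ)).const_mul (-(s : ℝ))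
      simpa [Function.comp_def] using (Real.continuous_exp.tendsto _).comp this
  have h0 : ∫ _, (1 : ℝ) ∂p = ∫ _, (1 : ℝ) ∂q := by
    refine tendsto_nhds_unique (hlim p) ((hlim q).congr fun n => (h _ (by positivity)).symm)
  have hk : ∀ k : ℕ, ∫ s : ℝ≥0, Real.exp (-(s : ℝ)) ^ k ∂p
      = ∫ s : ℝ≥0, Real.exp (-(s : ℝ)) ^ k ∂q := by
    intro k
    rcases Nat.eq_zero_or_pos k with rfl | hk
    · simpa using h0
    · have := h k (by exact_mod_cast hk)
      simpa only [← Real.exp_nat_mul, mul_comm] using this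
  set φ : BoundedContinuousFunction ℝ≥0 ℝ :=
    BoundedContinuousFunction.ofNormedAddCommGroup (fun s : ℝ≥0 => Real.exp (-(s : ℝ)))
      (by fun_prop) 1 (fun s => by simp)
  have hφ : ∀ s, φ s = Real.exp (-(s : ℝ)) := fun s => rfl
  -- The polynomials in `e^{-s}` separate points because `s ↦ e^{-s}` is injective, and their
  -- integrals are known from the transform at the integers.
  set A : StarSubalgebra ℝ (BoundedContinuousFunction ℝ≥0 ℝ) :=
    { Algebra.adjoin ℝ {φ} with
      star_mem' := by
        intro a ha
        have : star a = a := by ext x; simp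
        simpa [this] using! ha }
  refine ext_of_forall_mem_subalgebra_integral_eq_of_pseudoEMetric_complete_countable (𝕜 := ℝ)
    (A := A) ?_ ?_
  · intro x y hxy
    refine ⟨φ, ⟨φ.toContinuousMap, ⟨φ, ?_, rfl⟩, rfl⟩, ?_⟩
    · exact Algebra.subset_adjoin rfl
    · intro he
      change φ x = φ y at he
      rw [hφ, hφ] at he
      exact hxy (NNReal.coe_injective (neg_injective (Real.exp_injective he)))
  · intro g hg
    have hg' : g ∈ Algebra.adjoin ℝ {φ} := hg
    rw [Algebra.adjoin_singleton_eq_range_aeval] at hg'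
    obtain ⟨P, rfl⟩ := hg'
    have hP : ∀ s, (Polynomial.aeval φ P : BoundedContinuousFunction ℝ≥0 ℝ) s
        = ∑ i ∈ P.support, P.coeff i * Real.exp (-(s : ℝ)) ^ i := by
      intro s
      rw [Polynomial.aeval_eq_sum_range, ← Polynomial.sum_over_range' P (n := P.natDegree + 1)
        (f := fun i c => c • φ ^ i) (by simp) (by simp), Polynomial.sum]
      simp [hφ]
    change ∫ x, (Polynomial.aeval φ P : BoundedContinuousFunction ℝ≥0 ℝ) x ∂p
      = ∫ x, (Polynomial.aeval φ P : BoundedContinuousFunction ℝ≥0 ℝ) x ∂q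
    have hi : ∀ (r : Measure ℝ≥0) [IsFiniteMeasure r] (i : ℕ),
        Integrable (fun s : ℝ≥0 => Real.exp (-(s : ℝ)) ^ i) r := by
      intro r _ i
      refine Integrable.of_bound (by fun_prop : Continuous fun s : ℝ≥0 =>
        Real.exp (-(s : ℝ)) ^ i).aestronglyMeasurable 1 (Eventually.of_forall fun s => ?_)
      rw [norm_pow]
      exact pow_le_one₀ (norm_nonneg _) (by simp)
    simp only [hP]
    rw [integral_finsetSum _ fun i _ => (hi p i).const_mul _,
      integral_finsetSum _ fun i _ => (hi q i).const_mul _]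
    simp only [integral_const_mul, hk]

/-- The positive and negative parts of `w` define finite positive measures with equal Laplace
transforms, hence equal measures. -/
theorem density_real_eq_zero_of_laplace {m : Measure ℝ≥0} {w : ℝ≥0 → ℝ} (hw : Integrable w m)
    (h : ∀ z : ℝ, 0 < z → ∫ s, w s * Real.exp (-(s : ℝ) * z) ∂m = 0) :
    m.withDensityᵥ w = 0 := by
  have h1 := isFiniteMeasure_withDensity_ofReal hw.2
  have h2 := isFiniteMeasure_withDensity_ofReal hw.neg.2
  rw [withDensityᵥ_eq_withDensity_pos_part_sub_withDensity_neg_part hw]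
  have hpq : m.withDensity (fun x => ENNReal.ofReal (w x))
      = m.withDensity (fun x => ENNReal.ofReal (-w x)) := by
    have := h2
    simp only [Pi.neg_apply] at this
    refine measure_ext_of_laplace fun z hz => ?_
    have hb : ∀ u : ℝ≥0 → ℝ, Integrable u m →
        Integrable (fun s : ℝ≥0 => max (u s) 0 * Real.exp (-(s : ℝ) * z)) m := by
      intro u hu
      refine hu.pos_part.mul_bdd (c := 1) (by fun_prop : Continuous fun s : ℝ≥0 =>
        Real.exp (-(s : ℝ) * z)).aestronglyMeasurable (Eventually.of_forall fun s => ?_)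
      rw [Real.norm_eq_abs, Real.abs_exp]
      exact Real.exp_le_one_iff.2 (by nlinarith [s.coe_nonneg])
    have hd : ∀ u : ℝ≥0 → ℝ, Integrable u m →
        ∫ s, Real.exp (-(s : ℝ) * z) ∂m.withDensity (fun x => ENNReal.ofReal (u x))
          = ∫ s, max (u s) 0 * Real.exp (-(s : ℝ) * z) ∂m := by
      intro u hu
      rw [integral_withDensity_eq_integral_toReal_smul₀ hu.aemeasurable.ennreal_ofReal
        (Eventually.of_forall fun _ => ENNReal.ofReal_lt_top)]
      simp [ENNReal.toReal_ofReal', smul_eq_mul]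
    have hwn : Integrable (fun x => -w x) m := hw.neg
    rw [hd w hw, hd _ hwn, ← sub_eq_zero, ← integral_sub (hb _ hw) (hb _ hwn)]
    refine Eq.trans (integral_congr_ae (Eventually.of_forall fun s => ?_)) (h z hz)
    simp only
    rw [← sub_mul]
    congr 1
    exact max_zero_sub_max_neg_zero_eq_self (w s)
  simp only [hpq, sub_self]

/-- A bounded complex measure on `[0, ∞)` is determined by its Laplace transform on `(0, ∞)`. -/
theorem eq_of_laplace_eq {μ ν : ComplexMeasure ℝ≥0}
    (h : ∀ z : ℝ, 0 < z → laplace μ z = laplace ν z) : μ = ν := by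
  rw [← sub_eq_zero]
  have h0 : ∀ z : ℝ, 0 < z → laplace (μ - ν) z = 0 := fun z hz => by
    rw [laplace_sub _ _ (by simpa using hz), h z hz, sub_self]
  obtain ⟨m, w, -, hp⟩ := exists_presentation (μ - ν)
  have hw := hp.integrable
  have hwr : Integrable (fun s => (w s).re) m := hw.re
  have hwi : Integrable (fun s => (w s).im) m := hw.im
  have hint : ∀ z : ℝ, 0 < z →
      Integrable (fun s : ℝ≥0 => w s * Complex.exp (-((s : ℝ) : ℂ) * z)) m := fun z hz =>
    hw.mul_bdd (c := 1) (continuous_exp_neg_mul z).aestronglyMeasurable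
      (Eventually.of_forall fun s => norm_exp_neg_mul_le s (by simpa using hz))
  -- For real `z` the kernel is real, so the real and imaginary parts of the density can be treated
  -- separately.
  have hexp : ∀ (z : ℝ) (s : ℝ≥0), Complex.exp (-((s : ℝ) : ℂ) * z)
      = ((Real.exp (-(s : ℝ) * z) : ℝ) : ℂ) := by intros; push_cast; rfl
  have hre : m.withDensityᵥ (fun s => (w s).re) = 0 := by
    refine density_real_eq_zero_of_laplace hwr fun z hz => ?_
    have h1 := congrArg Complex.re (h0 z hz)
    rw [hp.laplace_eq (by simpa using hz)] at h1
    simp only [id] at h1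
    rw [← RCLike.re_eq_complex_re, ← integral_re (hint z hz)] at h1
    simpa only [hexp, Complex.re_mul_ofReal, Complex.zero_re, RCLike.re_eq_complex_re] using h1
  have him : m.withDensityᵥ (fun s => (w s).im) = 0 := by
    refine density_real_eq_zero_of_laplace hwi fun z hz => ?_
    have h1 := congrArg Complex.im (h0 z hz)
    rw [hp.laplace_eq (by simpa using hz)] at h1
    simp only [id] at h1
    rw [← RCLike.im_eq_complex_im, ← integral_im (hint z hz)] at h1
    simpa only [hexp, Complex.im_mul_ofReal, Complex.zero_im, RCLike.im_eq_complex_im] using h1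
  ext s hs
  rw [hp.apply_eq s hs, Set.preimage_id]
  have h1 : ∫ x in s, (w x).re ∂m = 0 := by
    rw [← withDensityᵥ_apply hwr hs, hre]; rfl
  have h2 : ∫ x in s, (w x).im ∂m = 0 := by
    rw [← withDensityᵥ_apply hwi hs, him]; rfl
  have h3 := integral_re_add_im (𝕜 := ℂ) (hw.mono_measure (Measure.restrict_le_self (s := s)))
  simp only [RCLike.re_eq_complex_re, RCLike.im_eq_complex_im, h1, h2] at h3
  simpa using h3.symm

/-! ### Bounded operators and their symbols -/

namespace BoundedC0Semigroup

variable {X : Type*} [NormedAddCommGroup X] [NormedSpace ℂ X] (S : BoundedC0Semigroup X)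

section Presented

variable [CompleteSpace X] {Ω : Type*} [MeasurableSpace Ω] {μ : ComplexMeasure ℝ≥0}
  {m : Measure Ω} {w : Ω → ℂ} {Y : Ω → ℝ≥0}

theorem hp_apply_eq (h : IsPresentedBy μ m w Y) (x : X) :
    S.hp μ x = ∫ ω, w ω • S.T (Y ω) x ∂m := by
  obtain ⟨C, hC⟩ := S.bounded
  exact h.cintegral_eq (S.continuous_orbit x) fun s => (S.T s).le_of_opNorm_le (hC s) x

omit [CompleteSpace X] in
theorem integrable_smul_orbit (h : IsPresentedBy μ m w Y) (x : X) :
    Integrable (fun ω => w ω • S.T (Y ω) x) m := by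
  obtain ⟨C, hC⟩ := S.bounded
  exact h.integrable.smul_bdd (C * ‖x‖)
    ((S.continuous_orbit x).stronglyMeasurable.comp_measurable h.measurable).aestronglyMeasurable
    (Eventually.of_forall fun ω => (S.T (Y ω)).le_of_opNorm_le (hC _) x)

theorem norm_hp_le (h : IsPresentedBy μ m w Y) {M : ℝ} (hM : ∀ t, ‖S.T t‖ ≤ M) :
    ‖S.hp μ‖ ≤ M * ∫ ω, ‖w ω‖ ∂m := by
  have hM0 : 0 ≤ M := (norm_nonneg _).trans (hM 0)
  refine ContinuousLinearMap.opNorm_le_bound _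
    (mul_nonneg hM0 (integral_nonneg fun _ => norm_nonneg _)) fun x => ?_
  rw [S.hp_apply_eq h]
  calc ‖∫ ω, w ω • S.T (Y ω) x ∂m‖ ≤ ∫ ω, ‖w ω‖ * (M * ‖x‖) ∂m := by
        refine norm_integral_le_of_norm_le (h.integrable.norm.mul_const _)
          (Eventually.of_forall fun ω => ?_)
        rw [norm_smul]
        exact mul_le_mul_of_nonneg_left ((S.T _).le_of_opNorm_le (hM _) x) (norm_nonneg _)
    _ = M * (∫ ω, ‖w ω‖ ∂m) * ‖x‖ := by rw [integral_mul_const]; ring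

end Presented

theorem hp_sub (μ ν : ComplexMeasure ℝ≥0) : S.hp (μ - ν) = S.hp μ - S.hp ν := by
  ext x
  exact VectorMeasure.integral_sub_vectorMeasure (S.integrable_orbit μ x) (S.integrable_orbit ν x)

/-- `B = g(A)` in the Hille-Phillips calculus: `g = ℒμ` and `B = H(ℒμ)` for a bounded measure `μ`. -/
def HasSymbol (g : ℂ → ℂ) (B : X →L[ℂ] X) : Prop :=
  ∃ μ : ComplexMeasure ℝ≥0, (∀ z : ℂ, 0 < z.re → laplace μ z = g z) ∧ S.hp μ = B

variable {S} {g g' : ℂ → ℂ} {B B' : X →L[ℂ] X}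

theorem hasSymbol_hp (μ : ComplexMeasure ℝ≥0) : S.HasSymbol (laplace μ) (S.hp μ) :=
  ⟨μ, fun _ _ => rfl, rfl⟩

theorem HasSymbol.congr (h : S.HasSymbol g B) (hg : ∀ z : ℂ, 0 < z.re → g z = g' z) :
    S.HasSymbol g' B := by
  obtain ⟨μ, h1, h2⟩ := h
  exact ⟨μ, fun z hz => (h1 z hz).trans (hg z hz), h2⟩

/-- Injectivity of the Laplace transform. All operator identities below, commutation included, are
read off from symbols in this way. -/
theorem HasSymbol.eq_of_forall (h : S.HasSymbol g B) (h' : S.HasSymbol g' B')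
    (hg : ∀ z : ℂ, 0 < z.re → g z = g' z) : B = B' := by
  obtain ⟨μ, h1, rfl⟩ := h
  obtain ⟨ν, h2, rfl⟩ := h'
  have : μ = ν := eq_of_laplace_eq fun z hz => by
    have hz' : 0 < (z : ℂ).re := by simpa using hz
    rw [h1 _ hz', h2 _ hz', hg _ hz']
  rw [this]

theorem HasSymbol.sub (h : S.HasSymbol g B) (h' : S.HasSymbol g' B') :
    S.HasSymbol (fun z => g z - g' z) (B - B') := by
  obtain ⟨μ, h1, rfl⟩ := h
  obtain ⟨ν, h2, rfl⟩ := h'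
  exact ⟨μ - ν, fun z hz => by rw [laplace_sub _ _ hz, h1 z hz, h2 z hz], S.hp_sub μ ν⟩

variable [CompleteSpace X]

theorem hasSymbol_T (t : ℝ≥0) :
    S.HasSymbol (fun z => Complex.exp (-((t : ℝ) : ℂ) * z)) (S.T t) := by
  obtain ⟨μ, hμ⟩ := exists_isPresentedBy (m := Measure.dirac ()) (w := fun _ => 1)
    (Y := fun _ => t) (integrable_const _) measurable_const
  refine ⟨μ, fun z hz => by simp [hμ.laplace_eq hz], ?_⟩
  ext x
  simp [S.hp_apply_eq hμ]

theorem hasSymbol_one : S.HasSymbol (fun _ => 1) 1 := by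
  have := hasSymbol_T (S := S) 0
  rw [S.map_zero] at this
  exact this.congr fun z _ => by simp

/-- The measure is the convolution, that is, the image of the product measure under addition. The
exponential law and the semigroup law play the same role in the two halves. -/
theorem HasSymbol.mul (h : S.HasSymbol g B) (h' : S.HasSymbol g' B') :
    S.HasSymbol (fun z => g z * g' z) (B * B') := by
  obtain ⟨μ, h1, rfl⟩ := h
  obtain ⟨ν, h2, rfl⟩ := h'
  obtain ⟨m, w, hm, hμ⟩ := exists_presentation μ
  obtain ⟨n, v, hn, hν⟩ := exists_presentation ν
  obtain ⟨κ, hκ⟩ := exists_isPresentedBy (m := m.prod n) (w := fun p => w p.1 * v p.2)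
    (Y := fun p => p.1 + p.2) (hμ.integrable.mul_prod hν.integrable) (by fun_prop)
  refine ⟨κ, fun z hz => ?_, ?_⟩
  · change laplace κ z = g z * g' z
    rw [hκ.laplace_eq hz, ← h1 z hz, ← h2 z hz, hμ.laplace_eq hz, hν.laplace_eq hz,
      ← integral_prod_mul]
    refine integral_congr_ae (Eventually.of_forall fun p => ?_)
    simp only [id, NNReal.coe_add, Complex.ofReal_add, neg_add, add_mul, Complex.exp_add]
    ring
  · ext x
    rw [mul_apply_eq_comp, S.hp_apply_eq hκ,
      integral_prod _ (S.integrable_smul_orbit hκ x), S.hp_apply_eq hμ, S.hp_apply_eq hν]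
    refine integral_congr_ae (Eventually.of_forall fun s => ?_)
    simp only [id, S.map_add, mul_apply_eq_comp, mul_smul]
    rw [integral_smul]
    congr 1
    have := (S.T s).integral_comp_comm (S.integrable_smul_orbit hν x)
    simpa using this

theorem HasSymbol.pow (h : S.HasSymbol g B) (n : ℕ) :
    S.HasSymbol (fun z => g z ^ n) (B ^ n) := by
  induction n with
  | zero => simpa using hasSymbol_one
  | succ n ih => simpa only [pow_succ] using ih.mul h

end BoundedC0Semigroup

/-! ### Families of Laplace transforms -/

/-- For `p` in a parameter space, `g p` is the Laplace transform of a complex measure of total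
variation at most `c p` which depends measurably on `p`. -/
def IsLaplaceFamily {P : Type} [MeasurableSpace P] (g : P → ℂ → ℂ) (c : P → ℝ) : Prop :=
  ∃ (Ω : Type) (_ : MeasurableSpace Ω) (m : Measure Ω) (w : P → Ω → ℂ) (Y : Ω → ℝ≥0),
    SFinite m ∧ Measurable (Function.uncurry w) ∧ Measurable Y ∧
    ∀ p, Integrable (w p) m ∧ ∫ ω, ‖w p ω‖ ∂m ≤ c p ∧
      ∀ z : ℂ, 0 < z.re → ∫ ω, w p ω * Complex.exp (-((Y ω : ℝ) : ℂ) * z) ∂m = g p z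

namespace IsLaplaceFamily

variable {P : Type} [MeasurableSpace P] {g g' : P → ℂ → ℂ} {c c' : P → ℝ}

theorem congr (h : IsLaplaceFamily g c) (hg : ∀ p (z : ℂ), 0 < z.re → g p z = g' p z)
    (hc : ∀ p, c p ≤ c' p) : IsLaplaceFamily g' c' := by
  obtain ⟨Ω, _, m, w, Y, h1, h2, h3, h4⟩ := h
  exact ⟨Ω, _, m, w, Y, h1, h2, h3, fun p => ⟨(h4 p).1, (h4 p).2.1.trans (hc p),
    fun z hz => ((h4 p).2.2 z hz).trans (hg p z hz)⟩⟩

theorem comp {Q : Type} [MeasurableSpace Q] {φ : Q → P} (h : IsLaplaceFamily g c)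
    (hφ : Measurable φ) : IsLaplaceFamily (fun q => g (φ q)) (fun q => c (φ q)) := by
  obtain ⟨Ω, _, m, w, Y, h1, h2, h3, h4⟩ := h
  exact ⟨Ω, _, m, fun q => w (φ q), Y, h1,
    h2.comp ((hφ.comp measurable_fst).prodMk measurable_snd), h3, fun q => h4 (φ q)⟩

theorem nonneg (h : IsLaplaceFamily g c) (p : P) : 0 ≤ c p := by
  obtain ⟨Ω, _, m, w, Y, h1, h2, h3, h4⟩ := h
  exact (integral_nonneg fun _ => norm_nonneg _).trans (h4 p).2.1

theorem exp_neg (t : ℝ≥0) :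
    IsLaplaceFamily (fun (_ : P) z => Complex.exp (-((t : ℝ) : ℂ) * z)) (fun _ => 1) :=
  ⟨Unit, _, Measure.dirac (), fun _ _ => 1, fun _ => t, inferInstance, measurable_const,
    measurable_const, fun _ => ⟨integrable_const _, by simp, fun z hz => by simp⟩⟩

theorem one : IsLaplaceFamily (fun (_ : P) _ => 1) (fun _ => 1) :=
  (exp_neg 0).congr (fun _ _ _ => by simp) fun _ => le_rfl

theorem const_mul (h : IsLaplaceFamily g c) {a : P → ℂ} (ha : Measurable a) :
    IsLaplaceFamily (fun p z => a p * g p z) (fun p => ‖a p‖ * c p) := by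
  obtain ⟨Ω, _, m, w, Y, h1, h2, h3, h4⟩ := h
  refine ⟨Ω, _, m, fun p ω => a p * w p ω, Y, h1, (ha.comp measurable_fst).mul h2, h3,
    fun p => ⟨(h4 p).1.const_mul _, ?_, fun z hz => ?_⟩⟩
  · simp only [norm_mul, integral_const_mul]
    exact mul_le_mul_of_nonneg_left (h4 p).2.1 (norm_nonneg _)
  · simp only [mul_assoc, integral_const_mul, (h4 p).2.2 z hz]

theorem mul (h : IsLaplaceFamily g c) (h' : IsLaplaceFamily g' c') :
    IsLaplaceFamily (fun p z => g p z * g' p z) (fun p => c p * c' p) := by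
  have hc := h.nonneg
  obtain ⟨Ω, _, m, w, Y, h1, h2, h3, h4⟩ := h
  obtain ⟨Ω', _, m', w', Y', h1', h2', h3', h4'⟩ := h'
  refine ⟨Ω × Ω', _, m.prod m', fun p ω => w p ω.1 * w' p ω.2, fun ω => Y ω.1 + Y' ω.2,
    inferInstance, ?_, by fun_prop, fun p => ⟨(h4 p).1.mul_prod (h4' p).1, ?_, fun z hz => ?_⟩⟩
  · exact (h2.comp (measurable_fst.prodMk (measurable_fst.comp measurable_snd))).mul
      (h2'.comp (measurable_fst.prodMk (measurable_snd.comp measurable_snd)))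
  · simp only [norm_mul]
    rw [integral_prod_mul (fun ω => ‖w p ω‖) (fun ω => ‖w' p ω‖)]
    exact mul_le_mul (h4 p).2.1 (h4' p).2.1 (integral_nonneg fun _ => norm_nonneg _) (hc p)
  · change _ = g p z * g' p z
    rw [← (h4 p).2.2 z hz, ← (h4' p).2.2 z hz, ← integral_prod_mul]
    refine integral_congr_ae (Eventually.of_forall fun p => ?_)
    simp only [NNReal.coe_add, Complex.ofReal_add, neg_add, add_mul, Complex.exp_add]
    ring

theorem pow (h : IsLaplaceFamily g c) (n : ℕ) :
    IsLaplaceFamily (fun p z => g p z ^ n) (fun p => c p ^ n) := by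
  induction n with
  | zero => simpa using one
  | succ n ih => simpa only [pow_succ] using ih.mul h

/-- The disjoint union of the two base spaces carries both densities at once. -/
theorem add (h : IsLaplaceFamily g c) (h' : IsLaplaceFamily g' c') :
    IsLaplaceFamily (fun p z => g p z + g' p z) (fun p => c p + c' p) := by
  obtain ⟨Ω, _, m, w, Y, h1, h2, h3, h4⟩ := h
  obtain ⟨Ω', _, m', w', Y', h1', h2', h3', h4'⟩ := h'
  have hint : ∀ {f : Ω ⊕ Ω' → ℂ}, Measurable f → Integrable (f ∘ Sum.inl) m →
      Integrable (f ∘ Sum.inr) m' → Integrable f (m.map Sum.inl + m'.map Sum.inr) := by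
    intro f hf ha hb
    refine Integrable.add_measure ?_ ?_
    · exact (integrable_map_measure hf.aestronglyMeasurable measurable_inl.aemeasurable).2 ha
    · exact (integrable_map_measure hf.aestronglyMeasurable measurable_inr.aemeasurable).2 hb
  have hval : ∀ {F : Type} [NormedAddCommGroup F] [NormedSpace ℝ F] {f : Ω ⊕ Ω' → F},
      Integrable f (m.map Sum.inl + m'.map Sum.inr) →
      ∫ ω, f ω ∂(m.map Sum.inl + m'.map Sum.inr)
        = ∫ ω, f (Sum.inl ω) ∂m + ∫ ω, f (Sum.inr ω) ∂m' := by
    intro F _ _ f hf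
    have hl := hf.mono_measure (Measure.le_add_right le_rfl : m.map Sum.inl ≤ _)
    have hr := hf.mono_measure (Measure.le_add_left le_rfl : m'.map Sum.inr ≤ _)
    rw [integral_add_measure hl hr,
      integral_map measurable_inl.aemeasurable hl.aestronglyMeasurable,
      integral_map measurable_inr.aemeasurable hr.aestronglyMeasurable]
  have hw : ∀ p, Measurable (Sum.elim (w p) (w' p)) := fun p =>
    Measurable.sumElim (h2.comp measurable_prodMk_left) (h2'.comp measurable_prodMk_left)
  have hY : Measurable (Sum.elim Y Y') := Measurable.sumElim h3 h3'
  have hi : ∀ p, Integrable (Sum.elim (w p) (w' p)) (m.map Sum.inl + m'.map Sum.inr) := fun p =>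
    hint (hw p) (by simpa using (h4 p).1) (by simpa using (h4' p).1)
  refine ⟨Ω ⊕ Ω', _, m.map Sum.inl + m'.map Sum.inr, fun p => Sum.elim (w p) (w' p),
    Sum.elim Y Y', inferInstance, ?_, hY, fun p => ⟨hi p, ?_, fun z hz => ?_⟩⟩
  · have hs : Function.uncurry (fun p => Sum.elim (w p) (w' p))
        = Sum.elim (Function.uncurry w) (Function.uncurry w') ∘
          (MeasurableEquiv.prodSumDistrib P Ω Ω') := by
      ext ⟨p, ω | ω⟩ <;> rfl
    rw [hs]
    exact (Measurable.sumElim h2 h2').comp (MeasurableEquiv.measurable _)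
  · rw [hval (hi p).norm]
    exact add_le_add (h4 p).2.1 (h4' p).2.1
  · change _ = g p z + g' p z
    rw [hval, ← (h4 p).2.2 z hz, ← (h4' p).2.2 z hz]
    · rfl
    · exact (hi p).mul_bdd (c := 1)
        ((continuous_exp_neg_mul z).measurable.comp hY).aestronglyMeasurable
        (Eventually.of_forall fun ω => norm_exp_neg_mul_le _ hz)

theorem sub (h : IsLaplaceFamily g c) (h' : IsLaplaceFamily g' c') :
    IsLaplaceFamily (fun p z => g p z - g' p z) (fun p => c p + c' p) :=
  (h.add (h'.const_mul (measurable_const (a := (-1 : ℂ))))).congr (fun _ _ _ => by ring)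
    fun _ => by simp

theorem sum {ι : Type} (s : Finset ι) {g : ι → P → ℂ → ℂ} {c : ι → P → ℝ}
    (h : ∀ i ∈ s, IsLaplaceFamily (g i) (c i)) :
    IsLaplaceFamily (fun p z => ∑ i ∈ s, g i p z) (fun p => ∑ i ∈ s, c i p) := by
  classical
  induction s using Finset.induction_on with
  | empty =>
    exact (one.const_mul (measurable_const (a := (0 : ℂ)))).congr (fun _ _ _ => by simp)
      fun _ => by simp
  | insert i s hi ih =>
    simp only [Finset.sum_insert hi]
    exact (h i (Finset.mem_insert_self i s)).add
      (ih fun j hj => h j (Finset.mem_insert_of_mem hj))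

/-- Indicator functions serve as parameter-dependent coefficients, which keeps the joint
measurability. -/
theorem piecewise (h : IsLaplaceFamily g c) (h' : IsLaplaceFamily g' c') {s : Set P}
    [DecidablePred (· ∈ s)] (hs : MeasurableSet s) :
    IsLaplaceFamily (fun p => if p ∈ s then g p else g' p)
      (fun p => if p ∈ s then c p else c' p) := by
  refine ((h.const_mul ((measurable_const (a := (1 : ℂ))).indicator hs)).add
    (h'.const_mul ((measurable_const (a := (1 : ℂ))).indicator hs.compl))).congr
    (fun p z _ => ?_) fun p => ?_
  · by_cases hp : p ∈ s <;> simp [hp]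
  · by_cases hp : p ∈ s <;> simp [hp]

/-- Superposition of a family of Laplace transforms. -/
theorem exists_superposition (h : IsLaplaceFamily g c) {μ : Measure P} [SFinite μ]
    (hc : Integrable c μ) :
    ∃ κ : ComplexMeasure ℝ≥0, (∀ z : ℂ, 0 < z.re → laplace κ z = ∫ p, g p z ∂μ) ∧
      ∀ {X : Type*} [NormedAddCommGroup X] [NormedSpace ℂ X] [CompleteSpace X]
        (S : BoundedC0Semigroup X) (M : ℝ), (∀ t, ‖S.T t‖ ≤ M) →
        ‖S.hp κ‖ ≤ M * ∫ p, c p ∂μ := by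
  obtain ⟨Ω, _, m, w, Y, h1, h2, h3, h4⟩ := h
  have hc' : Integrable (fun p => ∫ ω, ‖w p ω‖ ∂m) μ :=
    hc.mono' (h2.norm.stronglyMeasurable.integral_prod_right).aestronglyMeasurable
      (Eventually.of_forall fun p => by
        rw [Real.norm_of_nonneg (integral_nonneg fun _ => norm_nonneg _)]
        exact (h4 p).2.1)
  have hi : Integrable (Function.uncurry w) (μ.prod m) :=
    (integrable_prod_iff h2.aestronglyMeasurable).2
      ⟨Eventually.of_forall fun p => (h4 p).1, hc'⟩
  obtain ⟨κ, hκ⟩ := exists_isPresentedBy (Y := fun q : P × Ω => Y q.2) hi (h3.comp measurable_snd)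
  refine ⟨κ, fun z hz => ?_, ?_⟩
  · rw [hκ.laplace_eq hz, integral_prod]
    · exact integral_congr_ae (Eventually.of_forall fun p => (h4 p).2.2 z hz)
    · exact hi.mul_bdd (c := 1)
        ((continuous_exp_neg_mul z).measurable.comp (h3.comp measurable_snd)).aestronglyMeasurable
        (Eventually.of_forall fun ω => norm_exp_neg_mul_le _ hz)
  · intro X _ _ _ S M hM
    refine (S.norm_hp_le hκ hM).trans (mul_le_mul_of_nonneg_left ?_ ((norm_nonneg _).trans (hM 0)))
    rw [integral_prod _ hi.norm]
    exact integral_mono hc' hc fun p => (h4 p).2.1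

end IsLaplaceFamily

/-! ### Explicit transforms and the two bounds for Euler's error -/

theorem add_ofReal_ne_zero {z : ℂ} (hz : 0 < z.re) {τ : ℝ} (hτ : 0 ≤ τ) : z + τ ≠ 0 := by
  intro h
  have := congrArg Complex.re h
  simp only [Complex.add_re, Complex.ofReal_re, Complex.zero_re] at this
  linarith

theorem ne_zero_of_re_pos {z : ℂ} (hz : 0 < z.re) : z ≠ 0 := by
  simpa using add_ofReal_ne_zero hz le_rfl

theorem exp_neg_toNNReal {s : ℝ} (hs : s ∈ Set.Ioi (0 : ℝ)) (z : ℂ) :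
    Complex.exp (-((s.toNNReal : ℝ) : ℂ) * z) = Complex.exp (-z * s) := by
  rw [Real.coe_toNNReal _ (le_of_lt hs)]
  congr 1
  ring

theorem one_div_div_add {h : ℝ} (hh : 0 < h) {z : ℂ} (hz : 0 < z.re) :
    ((1 / h : ℝ) : ℂ) / (z + (1 / h : ℝ)) = 1 / (1 + h * z) := by
  have hh' : (h : ℂ) ≠ 0 := by exact_mod_cast hh.ne'
  have h1 := add_ofReal_ne_zero hz (show 0 ≤ 1 / h by positivity)
  rw [show (1 + h * z : ℂ) = h * (z + (1 / h : ℝ)) by push_cast; field_simp; ring]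
  push_cast at h1 ⊢
  field_simp

theorem integral_exp_neg_mul {a : ℂ} (ha : 0 < a.re) :
    ∫ s : ℝ in Set.Ioi 0, Complex.exp (-a * s) = 1 / a := by
  rw [integral_exp_mul_complex_Ioi (by simpa using ha)]
  simp

theorem integral_exp_neg_mul_real {a : ℝ} (ha : 0 < a) :
    ∫ s : ℝ in Set.Ioi 0, Real.exp (-a * s) = 1 / a := by
  have h := integral_exp_neg_mul (a := (a : ℂ)) (by simpa using ha)
  have h2 : ∀ s : ℝ, Complex.exp (-(a : ℂ) * s) = ((Real.exp (-a * s) : ℝ) : ℂ) := by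
    intro s; push_cast; rfl
  simp only [h2, integral_complex_ofReal] at h
  exact_mod_cast h

theorem integrableOn_exponential_density {l : ℝ} (hl : 0 < l) :
    IntegrableOn (fun s : ℝ => l * Real.exp (-l * s)) (Set.Ioi 0) :=
  (integrableOn_exp_mul_Ioi (by simpa using hl) 0).const_mul _

theorem integral_norm_exponential_density {l : ℝ} (hl : 0 < l) :
    ∫ s : ℝ in Set.Ioi 0, ‖((l * Real.exp (-l * s) : ℝ) : ℂ)‖ = 1 := by
  have : ∀ s : ℝ, ‖((l * Real.exp (-l * s) : ℝ) : ℂ)‖ = l * Real.exp (-l * s) := fun s => by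
    rw [Complex.norm_real, Real.norm_of_nonneg (by positivity)]
  simp only [this, integral_const_mul, integral_exp_neg_mul_real hl]
  rw [mul_one_div_cancel hl.ne']

theorem integral_exponential_density_mul_exp {l : ℝ} (hl : 0 < l) {z : ℂ} (hz : 0 < z.re) :
    ∫ s : ℝ in Set.Ioi 0, ((l * Real.exp (-l * s) : ℝ) : ℂ)
      * Complex.exp (-((s.toNNReal : ℝ) : ℂ) * z) = l / (z + l) := by
  have : Set.EqOn (fun s : ℝ => ((l * Real.exp (-l * s) : ℝ) : ℂ)
      * Complex.exp (-((s.toNNReal : ℝ) : ℂ) * z))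
      (fun s : ℝ => (l : ℂ) * Complex.exp (-(z + l) * s)) (Set.Ioi 0) := by
    intro s hs
    simp only
    rw [exp_neg_toNNReal hs, neg_add, add_mul, Complex.exp_add]
    push_cast
    ring
  rw [setIntegral_congr_fun measurableSet_Ioi this, integral_const_mul,
    integral_exp_neg_mul (by simpa using add_pos hz hl), mul_one_div]

namespace IsLaplaceFamily

/-- The Laplace transforms `τ / (z + τ)` of the exponential laws. -/
theorem exponential :
    IsLaplaceFamily (fun (τ : ℝ≥0) z => ((τ : ℝ) : ℂ) / (z + ((τ : ℝ) : ℂ))) (fun _ => 1) := by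
  refine ⟨ℝ, _, volume.restrict (Set.Ioi 0),
    fun τ s => (((τ : ℝ) * Real.exp (-(τ : ℝ) * s) : ℝ) : ℂ), Real.toNNReal, inferInstance, ?_,
    measurable_real_toNNReal, fun τ => ?_⟩
  · exact (by fun_prop : Continuous (Function.uncurry fun (τ : ℝ≥0) (s : ℝ) =>
      (((τ : ℝ) * Real.exp (-(τ : ℝ) * s) : ℝ) : ℂ))).measurable
  -- At `τ = 0` both the density and the symbol vanish, and the bound `1` holds trivially.
  rcases eq_or_ne τ 0 with rfl | hτ
  · simp
  have hτ' : (0 : ℝ) < τ := NNReal.coe_pos.2 (pos_iff_ne_zero.2 hτ)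
  exact ⟨(integrableOn_exponential_density hτ').ofReal,
    (integral_norm_exponential_density hτ').le,
    fun z hz => integral_exponential_density_mul_exp hτ' hz⟩

theorem integral_ramp {h : ℝ} (hh : 0 < h) {z : ℂ} (hz : z ≠ 0) :
    ∫ s : ℝ in Set.Ioi 0, ((max (h - s) 0 : ℝ) : ℂ) * Complex.exp (-z * s)
      = h / z - (1 - Complex.exp (-z * h)) / z ^ 2 := by
  have h1 : ∫ s : ℝ in Set.Ioi 0, ((max (h - s) 0 : ℝ) : ℂ) * Complex.exp (-z * s)
      = ∫ s : ℝ in Set.Ioc 0 h, ((max (h - s) 0 : ℝ) : ℂ) * Complex.exp (-z * s) := by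
    refine setIntegral_eq_of_subset_of_forall_sdiff_eq_zero measurableSet_Ioi
      (fun s hs => hs.1) fun s hs => ?_
    have : h < s := by
      by_contra hc
      exact hs.2 ⟨hs.1, not_lt.1 hc⟩
    rw [max_eq_right (by linarith)]
    simp
  have h2 : ∫ s : ℝ in Set.Ioc 0 h, ((max (h - s) 0 : ℝ) : ℂ) * Complex.exp (-z * s)
      = ∫ s : ℝ in Set.Ioc 0 h, ((h : ℂ) - s) * Complex.exp (-z * s) := by
    refine setIntegral_congr_fun measurableSet_Ioc fun s hs => ?_
    rw [max_eq_left (by linarith [hs.2])]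
    push_cast
    rfl
  rw [h1, h2, ← intervalIntegral.integral_of_le hh.le]
  have h3 : ∀ s ∈ Set.uIcc 0 h, HasDerivAt (fun s : ℝ => -((h : ℂ) - s) * Complex.exp (-z * s) / z
      + Complex.exp (-z * s) / z ^ 2) (((h : ℂ) - s) * Complex.exp (-z * s)) s := by
    intro s _
    have he : HasDerivAt (fun s : ℝ => Complex.exp (-z * s)) (Complex.exp (-z * s) * -z) s := by
      have := ((Complex.ofRealCLM.hasDerivAt (x := s)).const_mul (-z)).cexp
      simpa using this
    have hl : HasDerivAt (fun s : ℝ => -((h : ℂ) - s)) 1 s := by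
      have h4 : HasDerivAt (fun s : ℝ => (s : ℂ)) 1 s := Complex.ofRealCLM.hasDerivAt (x := s)
      have := (h4.const_sub (h : ℂ)).neg
      rw [neg_neg] at this
      exact this
    convert! ((hl.mul he).div_const z).add (he.div_const (z ^ 2)) using 1
    field_simp
    ring
  rw [intervalIntegral.integral_eq_sub_of_hasDerivAt h3
    ((by fun_prop : Continuous fun s : ℝ =>
      ((h : ℂ) - s) * Complex.exp (-z * s)).intervalIntegrable _ _)]
  simp
  field_simp
  ring

/-- One Euler step. The quotient is the Laplace transform of `h e^{-s/h} - (h - s)₊`. -/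
theorem step_div_sq {P : Type} [MeasurableSpace P] {h : ℝ} (hh : 0 < h) :
    IsLaplaceFamily (fun (_ : P) z => (1 / (1 + h * z) - Complex.exp (-h * z)) / z ^ 2)
      (fun _ => h ^ 2) := by
  have hh' : (h : ℂ) ≠ 0 := by exact_mod_cast hh.ne'
  have hi1 : IntegrableOn (fun s : ℝ => h * Real.exp (-(1 / h) * s)) (Set.Ioi 0) :=
    (integrableOn_exp_mul_Ioi (by simpa using hh) 0).const_mul _
  -- Positivity of the density, from `1 + u ≤ e^u` at `u = -s/h`.
  have hle : ∀ s : ℝ, max (h - s) 0 ≤ h * Real.exp (-(1 / h) * s) := by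
    intro s
    refine max_le ?_ (by positivity)
    have := Real.add_one_le_exp (-(1 / h) * s)
    calc h - s = h * (-(1 / h) * s + 1) := by field_simp; ring
      _ ≤ _ := mul_le_mul_of_nonneg_left this hh.le
  have hi2 : IntegrableOn (fun s : ℝ => max (h - s) 0) (Set.Ioi 0) :=
    hi1.mono' (by fun_prop : Continuous fun s : ℝ => max (h - s) 0).aestronglyMeasurable
      (Eventually.of_forall fun s => by
        rw [Real.norm_of_nonneg (le_max_right _ _)]; exact hle s)
  refine ⟨ℝ, _, volume.restrict (Set.Ioi 0),
    fun _ s => ((h * Real.exp (-(1 / h) * s) - max (h - s) 0 : ℝ) : ℂ),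
    Real.toNNReal, inferInstance, ?_, measurable_real_toNNReal, fun _ => ⟨(hi1.sub hi2).ofReal, ?_,
      fun z hz => ?_⟩⟩
  · exact (by fun_prop : Continuous fun s : ℝ =>
      ((h * Real.exp (-(1 / h) * s) - max (h - s) 0 : ℝ) : ℂ)).measurable.comp measurable_snd
  -- Dropping the ramp leaves mass `h²`; the exact mass is `h² / 2`.
  · have h1 : ∀ s : ℝ, ‖((h * Real.exp (-(1 / h) * s) - max (h - s) 0 : ℝ) : ℂ)‖
        ≤ h * Real.exp (-(1 / h) * s) := fun s => by
      rw [Complex.norm_real, Real.norm_of_nonneg (sub_nonneg.2 (hle s))]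
      linarith [le_max_right (h - s) 0]
    calc _ ≤ ∫ s in Set.Ioi 0, h * Real.exp (-(1 / h) * s) :=
          integral_mono (hi1.sub hi2).ofReal.norm hi1 h1
      _ = h ^ 2 := by
          rw [integral_const_mul, integral_exp_neg_mul_real (by positivity)]
          field_simp
  · have hz0 := ne_zero_of_re_pos hz
    have hre : 0 < ((1 / h : ℝ) + z : ℂ).re := by
      simpa using add_pos (inv_pos.2 hh) hz
    have h1 : Set.EqOn (fun s : ℝ => ((h * Real.exp (-(1 / h) * s) - max (h - s) 0 : ℝ) : ℂ)
        * Complex.exp (-((s.toNNReal : ℝ) : ℂ) * z))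
        (fun s : ℝ => (h : ℂ) * Complex.exp (-((1 / h : ℝ) + z) * s)
          - ((max (h - s) 0 : ℝ) : ℂ) * Complex.exp (-z * s)) (Set.Ioi 0) := by
      intro s hs
      simp only
      rw [exp_neg_toNNReal hs, neg_add, add_mul, Complex.exp_add]
      push_cast
      ring
    have hz' : (1 : ℂ) + h * z ≠ 0 := by
      intro hc
      have := congrArg Complex.re hc
      simp at this
      nlinarith [mul_pos hh hz]
    rw [setIntegral_congr_fun measurableSet_Ioi h1, integral_sub, integral_const_mul,
      integral_exp_neg_mul hre, integral_ramp hh hz0]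
    · have : ((1 / h : ℝ) + z : ℂ) = (1 + h * z) / h := by
        push_cast; field_simp
      rw [this, show -z * (h : ℂ) = -h * z by ring]
      field_simp
      ring
    · exact (integrableOn_exp_mul_complex_Ioi (by rw [Complex.neg_re]; linarith) 0).const_mul _
    · refine hi2.ofReal.mul_bdd (c := 1) (by fun_prop : Continuous fun s : ℝ =>
        Complex.exp (-z * s)).aestronglyMeasurable ?_
      filter_upwards [ae_restrict_mem measurableSet_Ioi] with s hs
      rw [← exp_neg_toNNReal hs]
      exact norm_exp_neg_mul_le _ hz

theorem step {P : Type} [MeasurableSpace P] {h : ℝ} (hh : 0 < h) :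
    IsLaplaceFamily (fun (_ : P) z => 1 / (1 + h * z)) (fun _ => 1) := by
  refine (exponential.comp (measurable_const (a := (1 / h).toNNReal))).congr
    (fun _ z hz => ?_) fun _ => le_rfl
  rw [Real.coe_toNNReal _ (by positivity)]
  exact one_div_div_add hh hz

/-- The symbol of the error of Euler's approximation. -/
theorem euler {P : Type} [MeasurableSpace P] {h : ℝ} (hh : 0 < h) (n : ℕ) :
    IsLaplaceFamily (fun (_ : P) z => (1 / (1 + h * z)) ^ n - Complex.exp (-h * z) ^ n)
      (fun _ => 2) :=
  (((step hh).pow n).sub ((exp_neg ⟨h, hh.le⟩).pow n)).congr (fun _ _ _ => rfl)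
    fun _ => by norm_num

/-- Telescoping: `aⁿ - bⁿ = (∑ aⁱ bⁿ⁻¹⁻ⁱ)(a - b)`, where `a` and `b` have mass bound `1` and `(a -
b) / z²` has mass bound `h²`. -/
theorem euler_div_sq {P : Type} [MeasurableSpace P] {h : ℝ} (hh : 0 < h) (n : ℕ) :
    IsLaplaceFamily
      (fun (_ : P) z => ((1 / (1 + h * z)) ^ n - Complex.exp (-h * z) ^ n) / z ^ 2)
      (fun _ => n * h ^ 2) := by
  have h1 := sum (P := P) (Finset.range n) fun i _ =>
    (((step hh).pow i).mul ((exp_neg ⟨h, hh.le⟩).pow (n - 1 - i))).mul (step_div_sq hh)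
  refine h1.congr (fun _ z _ => ?_) fun _ => by simp
  rw [← Finset.sum_mul, ← mul_div_assoc]
  exact congrArg (· / z ^ 2) ((Commute.all _ _).geom_sum₂_mul n)

/-- The heart of the estimate. For small `τ` write the symbol as `(H / z²)(1 - τ/(z + τ))²`, of mass
at most `4C / b²`; for large `τ` as `τ⁻² H (τ/(z + τ))²`, of mass at most `2C / τ²`. -/
theorem div_add_sq {H : ℂ → ℂ} {b C : ℝ} (hb : 0 < b) (hC : 0 ≤ C)
    (h1 : IsLaplaceFamily (fun (_ : ℝ≥0) => H) (fun _ => 2 * C))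
    (h2 : IsLaplaceFamily (fun (_ : ℝ≥0) z => H z / z ^ 2) (fun _ => C / b ^ 2)) :
    IsLaplaceFamily (fun (τ : ℝ≥0) z => H z / (z + ((τ : ℝ) : ℂ)) ^ 2)
      (fun τ => 12 * C / (b + (τ : ℝ)) ^ 2) := by
  classical
  -- The threshold `0.7 b` makes both bounds at most `12 C / (b + τ)²`: this needs `1.7² ≤ 3` below
  -- it and `(1 + 1/0.7)² ≤ 6` above it.
  have hs : MeasurableSet {τ : ℝ≥0 | (τ : ℝ) ≤ 0.7 * b} :=
    measurableSet_le (by fun_prop) measurable_const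
  have hsmall := h2.mul ((one.sub exponential).pow 2)
  have hlarge := (h1.mul (exponential.pow 2)).const_mul
    (a := fun τ : ℝ≥0 => (((1 / (τ : ℝ) ^ 2 : ℝ)) : ℂ)) (by fun_prop)
  refine (hsmall.piecewise hlarge hs).congr (fun τ z hz => ?_) fun τ => ?_
  · have hz0 := ne_zero_of_re_pos hz
    have hzτ := add_ofReal_ne_zero hz τ.coe_nonneg
    by_cases hτ : (τ : ℝ) ≤ 0.7 * b
    · simp only [Set.mem_ofPred_eq, hτ, if_true]
      rw [one_sub_div hzτ, add_sub_cancel_right, div_pow, div_mul_div_comm, mul_comm (H z),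
        mul_div_mul_left _ _ (pow_ne_zero 2 hz0)]
    · simp only [Set.mem_ofPred_eq, hτ, if_false]
      have : ((τ : ℝ) : ℂ) ≠ 0 := by
        have : (τ : ℝ) ≠ 0 := fun h => hτ (by rw [h]; positivity)
        exact_mod_cast this
      push_cast
      field_simp
  · have hτ0 := τ.coe_nonneg
    by_cases hτ : (τ : ℝ) ≤ 0.7 * b
    · simp only [Set.mem_ofPred_eq, hτ, if_true]
      rw [div_mul_eq_mul_div, div_le_div_iff₀ (by positivity) (by positivity)]
      have : (b + (τ : ℝ)) ^ 2 ≤ 3 * b ^ 2 := by nlinarith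
      nlinarith [mul_le_mul_of_nonneg_left this hC]
    · simp only [Set.mem_ofPred_eq, hτ, if_false]
      have hτ1 : 0.7 * b < τ := not_le.1 hτ
      have hτ2 : (0 : ℝ) < τ := by nlinarith
      rw [Complex.norm_real, Real.norm_of_nonneg (by positivity), one_pow, mul_one,
        div_mul_eq_mul_div, div_le_div_iff₀ (by positivity) (by positivity)]
      have : (b + (τ : ℝ)) ^ 2 ≤ 6 * (τ : ℝ) ^ 2 := by nlinarith
      nlinarith [mul_le_mul_of_nonneg_left this hC]

end IsLaplaceFamily

/-! ### Stieltjes functions and their holomorphic extensions -/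

/-- Here `μ` has density `1 / f` with respect to the finite measure `f μ`. It makes Fubini available
for the Stieltjes measure. -/
theorem sFinite_of_integrable_pos {α : Type*} [MeasurableSpace α] {μ : Measure α} {f : α → ℝ}
    (hf : Integrable f μ) (hm : Measurable f) (hpos : ∀ x, 0 < f x) : SFinite μ := by
  have := isFiniteMeasure_withDensity_ofReal hf.2
  rw [← withDensity_inv_same (μ := μ) hm.ennreal_ofReal
    (Eventually.of_forall fun x => (ENNReal.ofReal_pos.2 (hpos x)).ne')
    (Eventually.of_forall fun x => ENNReal.ofReal_ne_top)]
  infer_instance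

/-- In the right half-plane compare with `Re z + τ`. Off the real axis split `1 + τ = (1 + ‖z‖) + (τ
- ‖z‖)` and bound the first term through `|Im z| ≤ ‖z + τ‖`. -/
theorem exists_mul_le_norm_add {z : ℂ} (hz : z ∈ Complex.slitPlane) :
    ∃ δ : ℝ, 0 < δ ∧ ∀ τ : ℝ, 0 ≤ τ → δ * (1 + τ) ≤ ‖z + τ‖ := by
  rcases hz with hz | hz
  · refine ⟨min z.re 1, lt_min hz one_pos, fun τ hτ => ?_⟩
    have h1 : z.re + τ ≤ ‖z + τ‖ := by
      simpa using Complex.re_le_norm (z + τ)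
    nlinarith [min_le_left z.re 1, min_le_right z.re 1]
  · have hi : 0 < |z.im| := abs_pos.2 hz
    have hK : 0 < (1 + ‖z‖) / |z.im| + 1 := by positivity
    refine ⟨((1 + ‖z‖) / |z.im| + 1)⁻¹, inv_pos.2 hK, fun τ hτ => ?_⟩
    rw [inv_mul_le_iff₀ hK]
    have h1 : |z.im| ≤ ‖z + τ‖ := by simpa using Complex.abs_im_le_norm (z + τ)
    have h2 : τ - ‖z‖ ≤ ‖z + τ‖ := by
      have := norm_sub_norm_le (τ : ℂ) (-z)
      rw [norm_neg, sub_neg_eq_add, add_comm (τ : ℂ), Complex.norm_real,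
        Real.norm_of_nonneg hτ] at this
      exact this
    have h3 : 1 + ‖z‖ ≤ (1 + ‖z‖) / |z.im| * ‖z + τ‖ := by
      rw [div_mul_eq_mul_div, le_div_iff₀ hi]
      exact mul_le_mul_of_nonneg_left h1 (by positivity)
    linarith

/-- The holomorphic extension of `z ↦ a + ∫ (z + τ)⁻² μ(dτ)`. -/
noncomputable def stieltjesExtension (a : ℝ) (μ : Measure ℝ≥0) (z : ℂ) : ℂ :=
  a + ∫ τ : ℝ≥0, 1 / (z + ((τ : ℝ) : ℂ)) ^ 2 ∂μ

section Extension

variable {a : ℝ} {μ : Measure ℝ≥0}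

theorem norm_one_div_add_sq_le {z : ℂ} {δ : ℝ} (hδ : 0 < δ) {τ : ℝ≥0}
    (h : δ * (1 + (τ : ℝ)) ≤ ‖z + ((τ : ℝ) : ℂ)‖) :
    ‖1 / (z + ((τ : ℝ) : ℂ)) ^ 2‖ ≤ (1 / δ ^ 2) * (1 / (1 + (τ : ℝ)) ^ 2) := by
  have := τ.coe_nonneg
  rw [norm_div, norm_one, norm_pow, one_div_mul_one_div, ← mul_pow]
  gcongr

theorem measurable_one_div_add_pow (z : ℂ) (n : ℕ) :
    Measurable fun τ : ℝ≥0 => 1 / (z + ((τ : ℝ) : ℂ)) ^ n := by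
  fun_prop

theorem integrable_one_div_add_sq (hμ : Integrable (fun τ : ℝ≥0 => 1 / (1 + (τ : ℝ)) ^ 2) μ)
    {z : ℂ} (hz : z ∈ Complex.slitPlane) :
    Integrable (fun τ : ℝ≥0 => 1 / (z + ((τ : ℝ) : ℂ)) ^ 2) μ := by
  obtain ⟨δ, hδ, h⟩ := exists_mul_le_norm_add hz
  exact (hμ.const_mul (1 / δ ^ 2)).mono' (measurable_one_div_add_pow z 2).aestronglyMeasurable
    (Eventually.of_forall fun τ => norm_one_div_add_sq_le hδ (h τ τ.coe_nonneg))

theorem differentiableOn_stieltjesExtension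
    (hμ : Integrable (fun τ : ℝ≥0 => 1 / (1 + (τ : ℝ)) ^ 2) μ) :
    DifferentiableOn ℂ (stieltjesExtension a μ) Complex.slitPlane := by
  intro z hz
  obtain ⟨δ, hδ, h⟩ := exists_mul_le_norm_add hz
  -- Moving `z` by less than `δ / 2` costs at most half of `δ (1 + τ)`, since `1 + τ ≥ 1`; the
  -- domination is thus uniform on the ball.
  have hball : ∀ y ∈ Metric.ball z (δ / 2), ∀ τ : ℝ≥0,
      δ / 2 * (1 + (τ : ℝ)) ≤ ‖y + ((τ : ℝ) : ℂ)‖ := by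
    intro y hy τ
    have h1 := h τ τ.coe_nonneg
    have h2 : ‖z + ((τ : ℝ) : ℂ)‖ ≤ ‖y + ((τ : ℝ) : ℂ)‖ + ‖y - z‖ := by
      have := norm_sub_le (y + ((τ : ℝ) : ℂ)) (y - z)
      rw [show y + ((τ : ℝ) : ℂ) - (y - z) = z + ((τ : ℝ) : ℂ) by ring] at this
      exact this
    rw [mem_ball_iff_norm] at hy
    nlinarith [τ.coe_nonneg]
  have hne : ∀ y ∈ Metric.ball z (δ / 2), ∀ τ : ℝ≥0, y + ((τ : ℝ) : ℂ) ≠ 0 := by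
    intro y hy τ
    rw [← norm_pos_iff]
    refine lt_of_lt_of_le ?_ (hball y hy τ)
    have := τ.coe_nonneg
    positivity
  have hd := (hasDerivAt_integral_of_dominated_loc_of_deriv_le (μ := μ)
    (F := fun (y : ℂ) (τ : ℝ≥0) => 1 / (y + ((τ : ℝ) : ℂ)) ^ 2)
    (F' := fun (y : ℂ) (τ : ℝ≥0) => -2 * (1 / (y + ((τ : ℝ) : ℂ)) ^ 3))
    (bound := fun τ => 2 * (1 / (δ / 2)) * ((1 / (δ / 2) ^ 2) * (1 / (1 + (τ : ℝ)) ^ 2)))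
    (Metric.ball_mem_nhds z (half_pos hδ))
    (Eventually.of_forall fun y => (measurable_one_div_add_pow y 2).aestronglyMeasurable)
    (integrable_one_div_add_sq hμ hz)
    ((measurable_one_div_add_pow z 3).const_mul _).aestronglyMeasurable
    (Eventually.of_forall fun τ y hy => ?_) ((hμ.const_mul _).const_mul _)
    (Eventually.of_forall fun τ y hy => ?_)).2
  · exact (hd.const_add (a : ℂ)).differentiableAt.differentiableWithinAt
  · have h1 := norm_one_div_add_sq_le (half_pos hδ) (hball y hy τ)
    have h2 : ‖1 / (y + ((τ : ℝ) : ℂ))‖ ≤ 1 / (δ / 2) := by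
      rw [norm_div, norm_one]
      refine one_div_le_one_div_of_le (half_pos hδ) (le_trans ?_ (hball y hy τ))
      nlinarith [τ.coe_nonneg]
    have h3 : -2 * (1 / (y + ((τ : ℝ) : ℂ)) ^ 3)
        = -2 * ((1 / (y + ((τ : ℝ) : ℂ))) * (1 / (y + ((τ : ℝ) : ℂ)) ^ 2)) := by
      rw [one_div_mul_one_div_rev]; ring
    rw [h3, norm_mul, norm_mul, norm_neg, Complex.norm_ofNat, mul_assoc]
    gcongr
  · have h1 := hne y hy τ
    have h2 : HasDerivAt (fun y : ℂ => (y + ((τ : ℝ) : ℂ)) ^ 2) (2 * (y + ((τ : ℝ) : ℂ))) y := by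
      simpa using! ((hasDerivAt_id y).add_const ((τ : ℝ) : ℂ)).pow 2
    have h3 := h2.inv (pow_ne_zero 2 h1)
    simp only [one_div]
    convert! h3 using 1
    field_simp

theorem stieltjesExtension_ofReal {x : ℝ} :
    stieltjesExtension a μ x = ((a + ∫ τ : ℝ≥0, 1 / (x + (τ : ℝ)) ^ 2 ∂μ : ℝ) : ℂ) := by
  rw [stieltjesExtension, Complex.ofReal_add, ← integral_complex_ofReal]
  push_cast
  rfl

end Extension

/-- Identity theorem on the slit plane, which is star-shaped about `1`, along the real points `1 +
1/(n + 1) → 1`. -/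
theorem IsHolomorphicExtension.eqOn {f : ℝ → ℝ} {F G : ℂ → ℂ} (hF : IsHolomorphicExtension f F)
    (hG : IsHolomorphicExtension f G) : Set.EqOn F G Complex.slitPlane := by
  refine AnalyticOnNhd.eqOn_of_preconnected_of_frequently_eq (z₀ := 1)
    (hF.1.analyticOnNhd Complex.isOpen_slitPlane) (hG.1.analyticOnNhd Complex.isOpen_slitPlane)
    (Complex.starConvex_one_slitPlane.isPathConnected Complex.one_mem_slitPlane).isConnected.isPreconnected
    (by simp) ?_
  have h1 : Tendsto (fun n : ℕ => ((1 + 1 / ((n : ℝ) + 1) : ℝ) : ℂ)) atTop (𝓝[≠] 1) := by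
    refine tendsto_nhdsWithin_iff.2 ⟨?_, Eventually.of_forall fun n => ?_⟩
    · have := (tendsto_one_div_add_atTop_nhds_zero_nat (𝕜 := ℝ)).const_add 1
      rw [add_zero] at this
      exact (Complex.continuous_ofReal.tendsto 1).comp this
    · intro hc
      have h2 : (1 + 1 / ((n : ℝ) + 1) : ℝ) = 1 := by
        have hc' : ((1 + 1 / ((n : ℝ) + 1) : ℝ) : ℂ) = 1 := hc
        exact Complex.ofReal_eq_one.1 hc'
      have h3 : (0 : ℝ) < 1 / ((n : ℝ) + 1) := by positivity
      linarith
  refine h1.frequently (Eventually.frequently (Eventually.of_forall fun n => ?_))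
  have h2 : (0 : ℝ) < 1 + 1 / ((n : ℝ) + 1) := by positivity
  rw [hF.2 _ h2, hG.2 _ h2]

theorem isGenStieltjes_two_iff {f : ℝ → ℝ} : IsGenStieltjes 2 f ↔
    ∃ (a : ℝ) (μ : Measure ℝ≥0), 0 ≤ a ∧ Integrable (fun τ : ℝ≥0 => 1 / (1 + (τ : ℝ)) ^ 2) μ ∧
      ∀ z : ℝ, 0 < z → f z = a + ∫ τ : ℝ≥0, 1 / (z + (τ : ℝ)) ^ 2 ∂μ := by
  simp only [IsGenStieltjes, Real.rpow_two]

theorem isHolomorphicExtension_stieltjesExtension {f : ℝ → ℝ} {a : ℝ} {μ : Measure ℝ≥0}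
    (hμ : Integrable (fun τ : ℝ≥0 => 1 / (1 + (τ : ℝ)) ^ 2) μ)
    (hf : ∀ z : ℝ, 0 < z → f z = a + ∫ τ : ℝ≥0, 1 / (z + (τ : ℝ)) ^ 2 ∂μ) :
    IsHolomorphicExtension f (stieltjesExtension a μ) :=
  ⟨differentiableOn_stieltjesExtension hμ, fun x hx => by
    rw [stieltjesExtension_ofReal, hf x hx]⟩

theorem IsGenStieltjes.exists_isHolomorphicExtension {f : ℝ → ℝ} (hf : IsGenStieltjes 2 f) :
    ∃ F : ℂ → ℂ, IsHolomorphicExtension f F := by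
  obtain ⟨a, μ, -, hμ, hf⟩ := isGenStieltjes_two_iff.1 hf
  exact ⟨_, isHolomorphicExtension_stieltjesExtension hμ hf⟩

/-- Superposition of `H / (z + τ)²` over the Stieltjes measure, plus the constant term. The
parameters `b` and `C` serve two uses: Euler's error (`b = √n / t`, `C = 1`) and the regularizer (`b
= 1`, `C = 2`). -/
theorem IsGenStieltjes.exists_laplace_mul {f : ℝ → ℝ} (hf : IsGenStieltjes 2 f) {F : ℂ → ℂ}
    (hF : IsHolomorphicExtension f F) {H : ℂ → ℂ} {b C : ℝ} (hb : 0 < b) (hC : 0 ≤ C)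
    (h1 : IsLaplaceFamily (fun (_ : ℝ≥0) => H) (fun _ => 2 * C))
    (h2 : IsLaplaceFamily (fun (_ : ℝ≥0) z => H z / z ^ 2) (fun _ => C / b ^ 2)) :
    ∃ κ : ComplexMeasure ℝ≥0, (∀ z : ℂ, 0 < z.re → laplace κ z = H z * F z) ∧
      ∀ {X : Type*} [NormedAddCommGroup X] [NormedSpace ℂ X] [CompleteSpace X]
        (S : BoundedC0Semigroup X) (M : ℝ), (∀ t, ‖S.T t‖ ≤ M) →
        ‖S.hp κ‖ ≤ M * (12 * C * f b) := by
  obtain ⟨a, μ, ha, hμ, hf⟩ := isGenStieltjes_two_iff.1 hf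
  have hsf : SFinite μ := sFinite_of_integrable_pos hμ (by fun_prop) fun τ => by
    have := τ.coe_nonneg
    positivity
  have hext := hF.eqOn (isHolomorphicExtension_stieltjesExtension hμ hf)
  have hb2 : Integrable (fun τ : ℝ≥0 => 1 / (b + (τ : ℝ)) ^ 2) μ := by
    have := (integrable_one_div_add_sq hμ (z := b) (Or.inl (by simpa using hb))).re
    refine this.congr (Eventually.of_forall fun τ => ?_)
    simp only [RCLike.re_eq_complex_re]
    rw [← Complex.ofReal_add, ← Complex.ofReal_pow, ← Complex.ofReal_one, ← Complex.ofReal_div,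
      Complex.ofReal_re]
  have hc : (fun τ : ℝ≥0 => 12 * C / (b + (τ : ℝ)) ^ 2)
      = fun τ : ℝ≥0 => 12 * C * (1 / (b + (τ : ℝ)) ^ 2) := by
    ext τ; ring
  obtain ⟨κ, hκ, hκS⟩ := (IsLaplaceFamily.div_add_sq hb hC h1 h2).exists_superposition (μ := μ)
    (by rw [hc]; exact hb2.const_mul _)
  -- The constant term enters by subtracting a measure with symbol `-a H`, so that `laplace_sub` and
  -- `hp_sub` suffice.
  obtain ⟨κ₀, hκ₀, hκ₀S⟩ := (h1.const_mul
    (measurable_const (a := (-a : ℂ)))).exists_superposition (μ := Measure.dirac 0)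
    (integrable_const _)
  refine ⟨κ - κ₀, fun z hz => ?_, ?_⟩
  · rw [laplace_sub _ _ hz, hκ z hz, hκ₀ z hz, hext (Or.inl hz), stieltjesExtension]
    simp only [div_eq_mul_one_div (H z), integral_const_mul, integral_dirac]
    ring
  · intro X _ _ _ S M hM
    have h3 := hκS S M hM
    have h4 := hκ₀S S M hM
    have hM0 : 0 ≤ M := (norm_nonneg _).trans (hM 0)
    rw [hc, integral_const_mul] at h3
    simp only [norm_neg, Complex.norm_real, Real.norm_of_nonneg ha, integral_dirac] at h4
    rw [S.hp_sub, hf b hb]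
    refine (norm_sub_le _ _).trans ((add_le_add h3 h4).trans ?_)
    rw [← mul_add]
    refine mul_le_mul_of_nonneg_left ?_ hM0
    -- The constant term costs only `2aC`, which is at most `12aC`.
    nlinarith [mul_nonneg ha hC]

/-! ### Powers -/

theorem integrableOn_rpow_div_sq {β : ℝ} (h0 : 0 < β) (h2 : β < 2) :
    IntegrableOn (fun s : ℝ => s ^ (1 - β) * (1 / (1 + s) ^ 2)) (Set.Ioi 0) := by
  rw [← Set.Ioc_union_Ioi_eq_Ioi zero_le_one]
  have hm : Measurable fun s : ℝ => s ^ (1 - β) * (1 / (1 + s) ^ 2) := by fun_prop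
  refine IntegrableOn.union ?_ ?_
  · have h3 : IntegrableOn (fun s : ℝ => s ^ (1 - β)) (Set.Ioc 0 1) :=
      (intervalIntegrable_iff_integrableOn_Ioc_of_le zero_le_one).1
        (intervalIntegral.intervalIntegrable_rpow' (by linarith))
    refine h3.mono' hm.aestronglyMeasurable ?_
    filter_upwards [ae_restrict_mem measurableSet_Ioc] with s hs
    have hs0 := hs.1
    rw [Real.norm_of_nonneg (by positivity)]
    refine mul_le_of_le_one_right (by positivity) ?_
    rw [div_le_one (by positivity)]
    nlinarith
  · refine (integrableOn_Ioi_rpow_of_lt (a := -1 - β) (by linarith) one_pos).mono'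
      hm.aestronglyMeasurable ?_
    filter_upwards [ae_restrict_mem measurableSet_Ioi] with s hs
    have hs0 : 0 < s := one_pos.trans hs
    rw [Real.norm_of_nonneg (by positivity), show -1 - β = 1 - β - 2 by ring,
      Real.rpow_sub hs0 (1 - β), Real.rpow_two, mul_one_div]
    gcongr
    linarith

/-- Substitute `s ↦ z s`: the powers of `z` combine to `z · z^{1-β} · z⁻² = z^{-β}`. -/
theorem integral_rpow_div_add_sq {β z : ℝ} (hz : 0 < z) :
    ∫ s : ℝ in Set.Ioi 0, s ^ (1 - β) * (1 / (z + s) ^ 2)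
      = z ^ (-β) * ∫ s : ℝ in Set.Ioi 0, s ^ (1 - β) * (1 / (1 + s) ^ 2) := by
  have h := integral_comp_mul_left_Ioi (fun s : ℝ => s ^ (1 - β) * (1 / (z + s) ^ 2)) 0 hz
  rw [mul_zero, smul_eq_mul, eq_inv_mul_iff_mul_eq₀ hz.ne'] at h
  rw [← h, ← integral_const_mul, ← integral_const_mul]
  refine setIntegral_congr_fun measurableSet_Ioi fun s hs => ?_
  have hs0 : 0 < s := hs
  rw [Real.mul_rpow hz.le hs0.le, sub_eq_add_neg, Real.rpow_add hz, Real.rpow_one,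
    show (z + z * s) = z * (1 + s) by ring, mul_pow]
  field_simp

/-- The function `z ↦ z ^ (-β)` is a generalized Stieltjes function of order `2` if `0 ≤ β ≤ 2`. -/
theorem isGenStieltjes_rpow_neg {β : ℝ} (h0 : 0 ≤ β) (h2 : β ≤ 2) :
    IsGenStieltjes 2 fun z => z ^ (-β) := by
  rw [isGenStieltjes_two_iff]
  -- The endpoints are degenerate: `β = 0` is the constant `a = 1`, and `β = 2` is a unit mass at `τ
  -- = 0`. In between, the measure is `c⁻¹ s^{1-β} ds`.
  rcases h0.eq_or_lt with rfl | h0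
  · exact ⟨1, 0, zero_le_one, integrable_zero_measure, fun z _ => by simp⟩
  rcases h2.eq_or_lt with rfl | h2
  · refine ⟨0, Measure.dirac 0, le_rfl, integrable_dirac (by simp), fun z hz => ?_⟩
    simp only [integral_dirac, NNReal.coe_zero, add_zero, zero_add]
    rw [Real.rpow_neg hz.le, Real.rpow_two, one_div]
  set c := ∫ s : ℝ in Set.Ioi 0, s ^ (1 - β) * (1 / (1 + s) ^ 2)
  have hint := integrableOn_rpow_div_sq h0 h2
  have hc : 0 < c := by
    refine (setIntegral_pos_iff_support_of_nonneg_ae ?_ hint).2 ?_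
    · filter_upwards [ae_restrict_mem measurableSet_Ioi] with s hs
      have hs0 : 0 < s := hs
      simp only [Pi.zero_apply]
      positivity
    · refine lt_of_lt_of_le ?_ (measure_mono (s := Set.Ioi (0 : ℝ)) fun s hs => ?_)
      · simp
      · have hs0 : 0 < s := hs
        exact ⟨(by positivity : (0 : ℝ) < s ^ (1 - β) * (1 / (1 + s) ^ 2)).ne', hs⟩
  set ν : Measure ℝ := (volume.restrict (Set.Ioi 0)).withDensity
    fun s => ENNReal.ofReal (c⁻¹ * s ^ (1 - β))
  have hmeas : Measurable fun s : ℝ => ENNReal.ofReal (c⁻¹ * s ^ (1 - β)) := by fun_prop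
  have hfin : ∀ᵐ s : ℝ ∂volume.restrict (Set.Ioi 0), ENNReal.ofReal (c⁻¹ * s ^ (1 - β)) < ⊤ :=
    Eventually.of_forall fun _ => ENNReal.ofReal_lt_top
  have hg : ∀ z : ℝ, Measurable fun τ : ℝ≥0 => 1 / (z + (τ : ℝ)) ^ 2 := fun z => by fun_prop
  have hcongr : ∀ z : ℝ, Set.EqOn
      (fun s : ℝ => (ENNReal.ofReal (c⁻¹ * s ^ (1 - β))).toReal
        • (1 / (z + (s.toNNReal : ℝ)) ^ 2))
      (fun s : ℝ => c⁻¹ * (s ^ (1 - β) * (1 / (z + s) ^ 2))) (Set.Ioi 0) := by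
    intro z s hs
    have hs0 : 0 < s := hs
    simp only
    rw [ENNReal.toReal_ofReal (by positivity), Real.coe_toNNReal _ hs0.le, smul_eq_mul, mul_assoc]
  refine ⟨0, ν.map Real.toNNReal, le_rfl, ?_, fun z hz => ?_⟩
  · rw [integrable_map_measure (hg 1).aestronglyMeasurable measurable_real_toNNReal.aemeasurable,
      integrable_withDensity_iff_integrable_smul' hmeas hfin]
    exact (integrableOn_congr_fun (hcongr 1) measurableSet_Ioi).2 (hint.const_mul _)
  · rw [integral_map measurable_real_toNNReal.aemeasurable (hg z).aestronglyMeasurable,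
      integral_withDensity_eq_integral_toReal_smul hmeas hfin,
      setIntegral_congr_fun measurableSet_Ioi (hcongr z), integral_const_mul,
      integral_rpow_div_add_sq hz, zero_add]
    change _ = c⁻¹ * (z ^ (-β) * c)
    field_simp

theorem isHolomorphicExtension_cpow (β : ℝ) :
    IsHolomorphicExtension (fun z => z ^ β) fun z => z ^ (β : ℂ) :=
  ⟨fun _ hz => (differentiableAt_id.cpow_const hz).differentiableWithinAt,
    fun _ hx => (Complex.ofReal_cpow hx.le β).symm⟩

/-! ### The generator and its resolvent -/

namespace BoundedC0Semigroup

variable {X : Type*} [NormedAddCommGroup X] [NormedSpace ℂ X] {S : BoundedC0Semigroup X}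

theorem generator_eq {x y : X} (h : S.HasOrbitDeriv x y) (hx : x ∈ S.generator.domain) :
    S.generator ⟨x, hx⟩ = y :=
  tendsto_nhds_unique hx.choose_spec h

theorem hasOrbitDeriv_generator (x : S.generator.domain) :
    S.HasOrbitDeriv x (S.generator x) :=
  x.2.choose_spec

/-- Allows an orbit, given only for `t ≥ 0`, to be differentiated through any formula `G` that makes
sense on the whole line. -/
theorem hasOrbitDeriv_of_hasDerivAt {x y : X} {G : ℝ → X} (hG : HasDerivAt G y 0)
    (h : ∀ t : ℝ≥0, S.T t x = G t) : S.HasOrbitDeriv x y := by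
  have h1 := hasDerivAt_iff_tendsto_slope.1 hG
  have h2 : Tendsto (fun t : ℝ≥0 => (t : ℝ)) (𝓝[>] 0) (𝓝[≠] 0) := by
    refine tendsto_nhdsWithin_iff.2 ⟨?_, ?_⟩
    · exact (NNReal.continuous_coe.tendsto 0).mono_left nhdsWithin_le_nhds
    · filter_upwards [self_mem_nhdsWithin] with t ht
      exact (NNReal.coe_pos.2 ht).ne'
  refine (h1.comp h2).congr fun t => ?_
  have h0 : G 0 = x := by simpa [S.map_zero] using (h 0).symm
  simp only [Function.comp, slope_def_module, sub_zero]
  rw [h0, h t, ← Complex.coe_smul]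
  push_cast
  rfl

variable [CompleteSpace X]

variable (S) in
/-- The operator `(1 + hA)⁻¹`, where `-A` is the generator, as a Laplace transform. -/
theorem exists_hasSymbol_step {h : ℝ} (hh : 0 < h) :
    ∃ R : X →L[ℂ] X, S.HasSymbol (fun z => 1 / (1 + h * z)) R ∧
      (∀ x, S.HasOrbitDeriv (R x) ((1 / h : ℝ) • (R x - x))) ∧
      ∀ M : ℝ, (∀ t, ‖S.T t‖ ≤ M) → ‖R‖ ≤ M := by
  set l : ℝ := 1 / h
  have hl : 0 < l := by positivity
  obtain ⟨μ, hμ⟩ := exists_isPresentedBy (integrableOn_exponential_density hl).ofReal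
    measurable_real_toNNReal
  refine ⟨S.hp μ, ⟨μ, fun z hz => ?_, rfl⟩, fun x => ?_, fun M hM => ?_⟩
  · rw [hμ.laplace_eq hz]
    exact (integral_exponential_density_mul_exp hl hz).trans (one_div_div_add hh hz)
  · set φ : ℝ → X := fun s => (l * Real.exp (-l * s)) • S.T s.toNNReal x
    have hφ : Continuous φ :=
      (by fun_prop : Continuous fun s : ℝ => l * Real.exp (-l * s)).smul
        ((S.continuous_orbit x).comp continuous_real_toNNReal)
    have hR : S.hp μ x = ∫ s in Set.Ioi 0, φ s := by
      rw [S.hp_apply_eq hμ]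
      exact integral_congr_ae (Eventually.of_forall fun s => Complex.coe_smul _ _)
    have hi : IntegrableOn φ (Set.Ioi 0) :=
      (S.integrable_smul_orbit hμ x).congr (Eventually.of_forall fun s => Complex.coe_smul _ _)
    set y := S.hp μ x
    -- Shifting the integral gives `T(t) y = e^{lt} (y - ∫₀ᵗ φ)`, whose derivative at `0` is `l y -
    -- φ(0) = l (y - x)`.
    refine hasOrbitDeriv_of_hasDerivAt
      (G := fun t => Real.exp (l * t) • (y - ∫ s in (0 : ℝ)..t, φ s)) ?_ fun t => ?_
    · have h1 : HasDerivAt (fun t : ℝ => ∫ s in (0 : ℝ)..t, φ s) (φ 0) 0 :=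
        intervalIntegral.integral_hasDerivAt_right (hφ.intervalIntegrable _ _)
          (hφ.stronglyMeasurableAtFilter _ _) hφ.continuousAt
      have h2 : HasDerivAt (fun t : ℝ => Real.exp (l * t)) l 0 := by
        simpa using ((hasDerivAt_id (0 : ℝ)).const_mul l).exp
      convert! h2.smul (h1.const_sub y) using 1
      simp [φ, S.map_zero, sub_eq_neg_add]
    · have ht := t.coe_nonneg
      have h1 : y - ∫ s in (0 : ℝ)..t, φ s = ∫ s in Set.Ioi (t : ℝ), φ s := by
        rw [hR, intervalIntegral.integral_of_le ht, sub_eq_iff_eq_add, add_comm,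
          ← setIntegral_union (Set.Ioc_disjoint_Ioi le_rfl) measurableSet_Ioi
            (hi.mono_set Set.Ioc_subset_Ioi_self) (hi.mono_set (Set.Ioi_subset_Ioi ht)),
          Set.Ioc_union_Ioi_eq_Ioi ht]
      have h2 : ∫ s in Set.Ioi (t : ℝ), φ s = ∫ s in Set.Ioi (0 : ℝ), φ (s + t) := by
        have := (measurePreserving_add_right volume (t : ℝ)).setIntegral_preimage_emb
          (measurableEmbedding_addRight (t : ℝ)) φ (Set.Ioi (t : ℝ))
        rw [Set.preimage_add_const_Ioi, sub_self] at this
        exact this.symm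
      rw [h1, h2, ← integral_smul, hR, ← ContinuousLinearMap.integral_comp_comm _ hi]
      refine setIntegral_congr_fun measurableSet_Ioi fun s hs => ?_
      have hs0 : 0 < s := hs
      simp only [φ]
      rw [Real.toNNReal_add hs0.le ht, Real.toNNReal_coe, add_comm s.toNNReal t, S.map_add,
        mul_apply_eq_comp, smul_smul, ← Complex.coe_smul, map_smul, Complex.coe_smul]
      congr 1
      have he : Real.exp (-l * s) = Real.exp (l * t) * Real.exp (-l * (s + t)) := by
        rw [← Real.exp_add]
        congr 1
        ring
      rw [he]
      ring
  · refine (S.norm_hp_le hμ hM).trans_eq ?_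
    exact (congrArg (M * ·) (integral_norm_exponential_density hl)).trans (mul_one M)

end BoundedC0Semigroup

variable {X : Type*} [NormedAddCommGroup X] [NormedSpace ℂ X] {S : BoundedC0Semigroup X}

theorem IsResolventStep.eq {A : X →ₗ.[ℂ] X} {h : ℝ} {R R' : X →L[ℂ] X}
    (hR : IsResolventStep A h R) (hR' : IsResolventStep A h R') : R = R' := by
  ext x
  obtain ⟨hx, hx'⟩ := hR.1 x
  have := hR'.2 ⟨R x, hx⟩
  rw [hx'] at this
  exact this.symm

theorem IsResolventStep.injective {A : X →ₗ.[ℂ] X} {h : ℝ} {R : X →L[ℂ] X}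
    (hR : IsResolventStep A h R) : Function.Injective R := by
  rw [injective_iff_map_eq_zero]
  intro x hx
  obtain ⟨hd, he⟩ := hR.1 x
  have : (⟨R x, hd⟩ : A.domain) = 0 := Subtype.ext hx
  rw [this, LinearPMap.map_zero, smul_zero, add_zero, hx] at he
  exact he.symm

theorem IsResolventStep.resolventStep_eq {A : X →ₗ.[ℂ] X} {h : ℝ} {R : X →L[ℂ] X}
    (hR : IsResolventStep A h R) : resolventStep A h = R := by
  have hex : ∃ R, IsResolventStep A h R := ⟨R, hR⟩
  rw [resolventStep, dif_pos hex]
  exact hex.choose_spec.eq hR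

section

variable [CompleteSpace X] {A : X →ₗ.[ℂ] X}

theorem resolventStep_spec (hA : S.generator = -A) {h : ℝ} (hh : 0 < h) :
    IsResolventStep A h (resolventStep A h) ∧
      S.HasSymbol (fun z => 1 / (1 + h * z)) (resolventStep A h) ∧
      ∀ M : ℝ, (∀ t, ‖S.T t‖ ≤ M) → ‖resolventStep A h‖ ≤ M := by
  obtain ⟨R, hR, hd, hM⟩ := S.exists_hasSymbol_step hh
  have hAS : A = -S.generator := by rw [hA, neg_neg]
  have hstep : IsResolventStep A h R := by
    subst hAS
    refine ⟨fun x => ?_, fun x => ?_⟩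
    · have hm : R x ∈ S.generator.domain := ⟨_, hd x⟩
      refine ⟨hm, ?_⟩
      change R x + (h : ℂ) • -(S.generator ⟨R x, hm⟩) = x
      rw [BoundedC0Semigroup.generator_eq (hd x) hm, smul_neg,
        Complex.coe_smul, smul_smul, mul_one_div_cancel hh.ne', one_smul]
      abel
    · have h1 := BoundedC0Semigroup.hasOrbitDeriv_generator (S := S) x
      -- `R` commutes with the semigroup, so it carries the difference quotients of `x` to those of
      -- `R x`; uniqueness of the limit then gives the left inverse.
      have h2 : S.HasOrbitDeriv (R x) (R (S.generator x)) := by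
        refine ((R.continuous.tendsto _).comp h1).congr fun t => ?_
        have hc : R * S.T t = S.T t * R :=
          (hR.mul (BoundedC0Semigroup.hasSymbol_T t)).eq_of_forall
            ((BoundedC0Semigroup.hasSymbol_T t).mul hR) fun z _ => mul_comm _ _
        have hc' : R (S.T t x) = S.T t (R x) := congrArg (fun B : X →L[ℂ] X => B x) hc
        simp only [Function.comp, map_smul, map_sub, hc']
      have h3 : R (S.generator x) = (1 / h : ℝ) • (R x - x) :=
        tendsto_nhds_unique h2 (hd x)
      change R ((x : X) + (h : ℂ) • -(S.generator x)) = x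
      rw [map_add, map_smul, map_neg, h3, smul_neg, Complex.coe_smul, smul_smul,
        mul_one_div_cancel hh.ne', one_smul]
      abel
  rw [hstep.resolventStep_eq]
  exact ⟨hstep, hR, hM⟩

theorem hasSymbol_eulerError (hA : S.generator = -A) {n : ℕ} (hn : 1 ≤ n) {t : ℝ≥0}
    (ht : 0 < t) :
    S.HasSymbol (fun z => (1 / (1 + ((t / n : ℝ) : ℂ) * z)) ^ n
      - Complex.exp (-((t / n : ℝ) : ℂ) * z) ^ n) (eulerError S A n t) := by
  have hn0 : (n : ℂ) ≠ 0 := by exact_mod_cast (by omega : n ≠ 0)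
  have hn' : (0 : ℝ) < n := by exact_mod_cast hn
  have hh : (0 : ℝ) < t / n := div_pos (NNReal.coe_pos.2 ht) hn'
  refine (((resolventStep_spec hA hh).2.1.pow n).sub
    (BoundedC0Semigroup.hasSymbol_T t)).congr fun z _ => ?_
  rw [← Complex.exp_nat_mul]
  congr 2
  push_cast
  field_simp

/-- The operator `1 - (1 + A)⁻¹ = A (1 + A)⁻¹` is injective if `A` has dense range. -/
theorem one_sub_resolventStep_injective (hA : S.generator = -A)
    (hran : Dense (Set.range fun x : A.domain => A x)) :
    Function.Injective (1 - resolventStep A 1 : X →L[ℂ] X) := by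
  rw [injective_iff_map_eq_zero]
  intro x hx
  obtain ⟨M, hM⟩ := S.bounded
  have hM0 : 0 ≤ M := (norm_nonneg _).trans (hM 0)
  have hx1 : resolventStep A 1 x = x := (sub_eq_zero.1 hx).symm
  obtain ⟨hd, he⟩ := (resolventStep_spec hA one_pos).1.1 x
  simp only [hx1] at hd
  have hAx : A ⟨x, hd⟩ = 0 := by simpa [hx1] using he
  -- A kernel vector of `1 - (1 + A)⁻¹` satisfies `A x = 0`, so every `(1 + hA)⁻¹` fixes it.
  have hfix : ∀ h : ℝ, 0 < h → resolventStep A h x = x := by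
    intro h hh
    simpa [hAx] using (resolventStep_spec hA hh).1.2 ⟨x, hd⟩
  -- With `R = (1 + hA)⁻¹`, `x = R (x - A v) + R A v` and `R A v = (v - R v) / h → 0` as `h = k + 1
  -- → ∞`. By density `A v` may be replaced by any `y`, and `y = x` forces `x = 0`.
  have hbd : ∀ v : A.domain, ‖x‖ ≤ M * ‖x - A v‖ := by
    intro v
    have h1 : ∀ k : ℕ, ‖x‖ ≤ M * ‖x - A v‖ + (1 / ((k : ℝ) + 1)) * (1 + M) * ‖(v : X)‖ := by
      intro k
      have hk : (0 : ℝ) < k + 1 := by positivity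
      have hk' : ((k : ℝ) + 1 : ℝ) ≠ 0 := hk.ne'
      obtain ⟨hR, -, hRM⟩ := resolventStep_spec hA hk
      set R := resolventStep A (k + 1)
      have h2 := hR.2 v
      rw [map_add, map_smul, Complex.coe_smul] at h2
      have h3 : R (A v) = (1 / ((k : ℝ) + 1)) • ((v : X) - R v) := by
        rw [sub_eq_of_eq_add' h2.symm, smul_smul, one_div_mul_cancel hk', one_smul]
      have h4 : x = R (x - A v) + R (A v) := by
        rw [← map_add, sub_add_cancel, hfix _ hk]
      have h5 : ‖R (x - A v)‖ ≤ M * ‖x - A v‖ := R.le_of_opNorm_le (hRM M hM) _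
      have h6 : ‖R (A v)‖ ≤ (1 / ((k : ℝ) + 1)) * (1 + M) * ‖(v : X)‖ := by
        rw [h3, norm_smul, Real.norm_of_nonneg (by positivity), mul_assoc]
        refine mul_le_mul_of_nonneg_left ?_ (by positivity)
        have := R.le_of_opNorm_le (hRM M hM) (v : X)
        linarith [norm_sub_le (v : X) (R v)]
      calc ‖x‖ = ‖R (x - A v) + R (A v)‖ := by rw [← h4]
        _ ≤ _ := (norm_add_le _ _).trans (add_le_add h5 h6)
    have h2 := (((tendsto_one_div_add_atTop_nhds_zero_nat (𝕜 := ℝ)).mul_const (1 + M)).mul_const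
      ‖(v : X)‖).const_add (M * ‖x - A v‖)
    rw [zero_mul, zero_mul, add_zero] at h2
    exact ge_of_tendsto' h2 h1
  have hcl : IsClosed {y : X | ‖x‖ ≤ M * ‖x - y‖} :=
    isClosed_le continuous_const (by fun_prop)
  have hall : ∀ y : X, ‖x‖ ≤ M * ‖x - y‖ := fun y =>
    hcl.closure_subset_iff.2 (by rintro _ ⟨v, rfl⟩; exact hbd v) (hran y)
  simpa using hall x

end

/-! ### The unbounded calculus against bounded operators -/

namespace BoundedC0Semigroup

/-- The regularizer here is the one picked by choice. Later arguments use only its symbol identity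
and injectivity, so independence of the regularizer is never needed. -/
theorem calculus_spec {F : ℂ → ℂ} (h : S.Regularizable F) :
    ∃ ν ρ : ComplexMeasure ℝ≥0, S.IsRegularizedBy F ν ρ ∧
      (∀ x y, S.hp ν y = S.hp ρ x → x ∈ (S.calculus F).domain) ∧
      ∀ x : (S.calculus F).domain, S.hp ν (S.calculus F x) = S.hp ρ x := by
  have hc : S.calculus F
      = invComp (S.hp h.choose.1) (S.hp h.choose.2) h.choose_spec.injective := dif_pos h
  refine ⟨h.choose.1, h.choose.2, h.choose_spec, ?_⟩
  rw [hc]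
  refine ⟨fun x y hxy => ⟨y, hxy⟩, fun x => ?_⟩
  exact congrArg Subtype.val ((LinearEquiv.ofInjective (S.hp h.choose.1 : X →ₗ[ℂ] X)
    h.choose_spec.injective).apply_symm_apply _)

variable [CompleteSpace X]

/-- With `e` the chosen regularizer, comparing symbols gives `e(A) B = (eF)(A) D = D (eF)(A)`;
cancelling the injective `e(A)` yields `F(A) D = B` and `D F(A) ⊆ B`. -/
theorem HasSymbol.calculus_apply {F d : ℂ → ℂ} {D B : X →L[ℂ] X} (h : S.Regularizable F)
    (hD : S.HasSymbol d D) (hB : S.HasSymbol (fun z => d z * F z) B) :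
    (∀ x, ∃ hx : D x ∈ (S.calculus F).domain, S.calculus F ⟨D x, hx⟩ = B x) ∧
      ∀ y : (S.calculus F).domain, D (S.calculus F y) = B y := by
  obtain ⟨ν, ρ, hreg, hdom, hval⟩ := calculus_spec h
  have h1 : S.hp ν * B = S.hp ρ * D :=
    ((hasSymbol_hp ν).mul hB).eq_of_forall ((hasSymbol_hp ρ).mul hD) fun z hz => by
      rw [← hreg.mul_eq z hz]; ring
  have h2 : S.hp ν * D = D * S.hp ν :=
    ((hasSymbol_hp ν).mul hD).eq_of_forall (hD.mul (hasSymbol_hp ν)) fun z _ => mul_comm _ _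
  have h3 : D * S.hp ρ = S.hp ν * B :=
    (hD.mul (hasSymbol_hp ρ)).eq_of_forall ((hasSymbol_hp ν).mul hB) fun z hz => by
      rw [← hreg.mul_eq z hz]; ring
  have happ : ∀ {U V : X →L[ℂ] X} (_ : U = V) (x : X), U x = V x := fun h x => by rw [h]
  refine ⟨fun x => ⟨hdom _ (B x) (happ h1 x), hreg.injective ?_⟩, fun y => hreg.injective ?_⟩
  · rw [hval]
    exact (happ h1 x).symm
  · calc S.hp ν (D (S.calculus F y)) = D (S.hp ν (S.calculus F y)) := happ h2 _
      _ = D (S.hp ρ y) := by rw [hval]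
      _ = S.hp ν (B y) := happ h3 _

end BoundedC0Semigroup

/-! ### Regularizability and the error estimates -/

section

variable [CompleteSpace X] {A : X →ₗ.[ℂ] X}

open BoundedC0Semigroup

theorem isLaplaceFamily_regularizer :
    IsLaplaceFamily (fun (_ : ℝ≥0) (z : ℂ) => (1 - 1 / (1 + ((1 : ℝ) : ℂ) * z)) ^ 2)
      (fun _ => 2 * 2) :=
  ((IsLaplaceFamily.one.sub (IsLaplaceFamily.step one_pos)).pow 2).congr (fun _ _ _ => rfl)
    fun _ => by norm_num

theorem regularizer_eq {z : ℂ} (hz : 0 < z.re) :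
    (1 - 1 / (1 + ((1 : ℝ) : ℂ) * z)) ^ 2 = z ^ 2 * (1 / (1 + ((1 : ℝ) : ℂ) * z)) ^ 2 := by
  have h1 := add_ofReal_ne_zero hz zero_le_one
  rw [add_comm, Complex.ofReal_one] at h1
  rw [Complex.ofReal_one, one_mul, one_sub_div h1, add_sub_cancel_left, ← mul_pow, mul_one_div]

theorem IsGenStieltjes.exists_laplace_regularizer_mul {f : ℝ → ℝ} (hf : IsGenStieltjes 2 f)
    {F : ℂ → ℂ} (hF : IsHolomorphicExtension f F) :
    ∃ κ : ComplexMeasure ℝ≥0, ∀ z : ℂ, 0 < z.re →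
      laplace κ z = (1 - 1 / (1 + ((1 : ℝ) : ℂ) * z)) ^ 2 * F z := by
  -- Here `H / z² = (1 + z)⁻²` has mass at most `1`, below `C / b² = 2`. The norm bound is
  -- discarded, so the universe of its spaces is fixed arbitrarily.
  obtain ⟨κ, hκ, -⟩ := IsGenStieltjes.exists_laplace_mul.{0} hf hF one_pos zero_le_two isLaplaceFamily_regularizer
    (((IsLaplaceFamily.step one_pos).pow 2).congr (fun _ z hz => by
      rw [regularizer_eq hz, mul_div_cancel_left₀ _ (pow_ne_zero 2 (ne_zero_of_re_pos hz))])
      fun _ => by norm_num)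
  exact ⟨κ, hκ⟩

theorem IsGenStieltjes.regularizable (hA : S.generator = -A)
    (hran : Dense (Set.range fun x : A.domain => A x)) {f : ℝ → ℝ} (hf : IsGenStieltjes 2 f)
    {F : ℂ → ℂ} (hF : IsHolomorphicExtension f F) : S.Regularizable F := by
  obtain ⟨κ, hκ⟩ := hf.exists_laplace_regularizer_mul hF
  obtain ⟨ν, hν, hνA⟩ := (hasSymbol_one.sub (resolventStep_spec hA one_pos).2.1).pow 2
  refine ⟨(ν, κ), hF.1.mono fun z hz => Or.inl hz, fun z hz => by rw [hν z hz, hκ z hz], ?_⟩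
  rw [hνA, pow_two]
  have hinj := one_sub_resolventStep_injective hA hran
  exact hinj.comp hinj

/-- The regularizer is `(1 + z)⁻²`, since `z^α (1 + z)⁻² = (z / (1 + z))² z^{-(2-α)}` and the last
factor is Stieltjes of order `2`. Its operator is a squared resolvent, hence injective without any
condition on the range. -/
theorem regularizable_cpow (hA : S.generator = -A) {α : ℝ} (h0 : 0 < α) (h2 : α ≤ 2) :
    S.Regularizable fun z => z ^ (α : ℂ) := by
  obtain ⟨κ, hκ⟩ := (isGenStieltjes_rpow_neg (sub_nonneg.2 h2)
    (by linarith)).exists_laplace_regularizer_mul (isHolomorphicExtension_cpow _)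
  obtain ⟨hR, hRs, -⟩ := resolventStep_spec hA one_pos
  obtain ⟨ν, hν, hνA⟩ := hRs.pow 2
  refine ⟨(ν, κ), (isHolomorphicExtension_cpow α).1.mono fun z hz => Or.inl hz, fun z hz => ?_, ?_⟩
  · have h3 : z ^ 2 * z ^ ((-(2 - α) : ℝ) : ℂ) = z ^ (α : ℂ) := by
      rw [← Complex.cpow_ofNat, ← Complex.cpow_add _ _ (ne_zero_of_re_pos hz)]
      congr 1
      push_cast
      ring
    rw [hν z hz, hκ z hz, regularizer_eq hz, ← h3]
    ring
  · rw [hνA, pow_two]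
    exact hR.injective.comp hR.injective

theorem IsGenStieltjes.exists_hasSymbol_eulerError_mul (hA : S.generator = -A) {f : ℝ → ℝ}
    (hf : IsGenStieltjes 2 f) {F : ℂ → ℂ} (hF : IsHolomorphicExtension f F) {M : ℝ}
    (hM : ∀ t, ‖S.T t‖ ≤ M) {n : ℕ} (hn : 1 ≤ n) {t : ℝ≥0} (ht : 0 < t) :
    ∃ d : ℂ → ℂ, S.HasSymbol d (eulerError S A n t) ∧ ∃ B : X →L[ℂ] X,
      S.HasSymbol (fun z => d z * F z) B ∧ ‖B‖ ≤ 12 * M * f (√(n : ℝ) / t) := by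
  have hn' : (0 : ℝ) < n := by exact_mod_cast hn
  have ht' : (0 : ℝ) < t := NNReal.coe_pos.2 ht
  have hh : (0 : ℝ) < t / n := div_pos ht' hn'
  -- The choice of `b` is forced by `n (t/n)² = t²/n = 1 / b²`.
  obtain ⟨κ, hκ, hκS⟩ := hf.exists_laplace_mul hF (b := √(n : ℝ) / t) (by positivity) zero_le_one
    ((IsLaplaceFamily.euler hh n).congr (fun _ _ _ => rfl) fun _ => by norm_num)
    ((IsLaplaceFamily.euler_div_sq hh n).congr (fun _ _ _ => rfl) fun _ => by
      rw [div_pow, div_pow, Real.sq_sqrt hn'.le]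
      apply le_of_eq
      field_simp)
  refine ⟨_, hasSymbol_eulerError hA hn ht, S.hp κ, ⟨κ, hκ, rfl⟩, (hκS S M hM).trans_eq ?_⟩
  ring

/-- Let `B` have symbol `d(z) z^{-α}`, where `d` is the symbol of the error. Since `z^{-α} z^α = 1`,
cancelling the regularizer of `z^α` gives `Δ x = B A^α x`, and the norm of `B` is already bounded.
-/
theorem norm_eulerError_le_fracPow (hA : S.generator = -A) {M : ℝ} (hM : ∀ t, ‖S.T t‖ ≤ M)
    {α : ℝ} (h0 : 0 < α) (h2 : α ≤ 2) (x : (S.fracPow α).domain) {n : ℕ} (hn : 1 ≤ n) {t : ℝ≥0}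
    (ht : 0 < t) :
    ‖eulerError S A n t (x : X)‖
      ≤ 12 * M * ‖S.fracPow α x‖ * ((t : ℝ) / √(n : ℝ)) ^ α := by
  have hn' : (0 : ℝ) < n := by exact_mod_cast hn
  have ht' : (0 : ℝ) < t := NNReal.coe_pos.2 ht
  obtain ⟨d, hd, B, hB, hBM⟩ := (isGenStieltjes_rpow_neg h0.le h2).exists_hasSymbol_eulerError_mul hA
    (isHolomorphicExtension_cpow (-α)) hM hn ht
  obtain ⟨ν, ρ, hreg, -, hval⟩ := calculus_spec (regularizable_cpow hA h0 h2)
  have h1 : S.hp ν * eulerError S A n t = B * S.hp ρ :=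
    ((hasSymbol_hp ν).mul hd).eq_of_forall (hB.mul (hasSymbol_hp ρ)) fun z hz => by
      have hz0 := ne_zero_of_re_pos hz
      have h3 : z ^ ((-α : ℝ) : ℂ) * z ^ (α : ℂ) = 1 := by
        rw [← Complex.cpow_add _ _ hz0]
        simp
      rw [← hreg.mul_eq z hz]
      linear_combination -(laplace ν z * d z) * h3
  have h2 : B * S.hp ν = S.hp ν * B :=
    (hB.mul (hasSymbol_hp ν)).eq_of_forall ((hasSymbol_hp ν).mul hB) fun z _ => mul_comm _ _
  have happ : ∀ {U V : X →L[ℂ] X} (_ : U = V) (x : X), U x = V x := fun h x => by rw [h]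
  have h3 : eulerError S A n t (x : X) = B (S.fracPow α x) := by
    refine hreg.injective ?_
    calc S.hp ν (eulerError S A n t (x : X)) = B (S.hp ρ x) := happ h1 _
      _ = B (S.hp ν (S.fracPow α x)) := congrArg B (hval x).symm
      _ = S.hp ν (B (S.fracPow α x)) := happ h2 _
  have h4 : (√(n : ℝ) / t) ^ (-α) = ((t : ℝ) / √(n : ℝ)) ^ α := by
    rw [Real.rpow_neg (by positivity), ← Real.inv_rpow (by positivity), inv_div]
  rw [h3, ← h4]
  refine (B.le_of_opNorm_le hBM _).trans_eq ?_
  ring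

end

end EulerApprox

theorem theorem5p1 {X : Type*} [NormedAddCommGroup X] [NormedSpace ℂ X] [CompleteSpace X]
    (S : EulerApprox.BoundedC0Semigroup X) (A : X →ₗ.[ℂ] X) (hA : S.generator = -A)
    (hran : Dense (Set.range fun x : A.domain => A x))
    (M : ℝ) (hM : IsLUB (Set.range fun t : ℝ≥0 => ‖S.T t‖) M) :
    -- the operators `(1 + hA)⁻¹` exist
    (∀ h : ℝ, 0 < h → EulerApprox.IsResolventStep A h (EulerApprox.resolventStep A h)) ∧
    (∀ f : ℝ → ℝ, EulerApprox.IsGenStieltjes 2 f →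
      (∃ F : ℂ → ℂ, EulerApprox.IsHolomorphicExtension f F) ∧
      ∀ F : ℂ → ℂ, EulerApprox.IsHolomorphicExtension f F →
        S.Regularizable F ∧
        (∀ (x : X) (n : ℕ) (t : ℝ≥0), 1 ≤ n → 0 < t →
          ∃ hx : EulerApprox.eulerError S A n t x ∈ (S.calculus F).domain,
            ‖S.calculus F ⟨EulerApprox.eulerError S A n t x, hx⟩‖
              ≤ 12 * M * ‖x‖ * f (√(n : ℝ) / t)) ∧
        (∀ (y : (S.calculus F).domain) (n : ℕ) (t : ℝ≥0), 1 ≤ n → 0 < t →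
          ‖EulerApprox.eulerError S A n t (S.calculus F y)‖
            ≤ 12 * M * ‖(y : X)‖ * f (√(n : ℝ) / t))) ∧
    (∀ α : ℝ, 0 < α → α ≤ 2 →
      S.Regularizable (fun z => z ^ (α : ℂ)) ∧
      ∀ (x : (S.fracPow α).domain) (n : ℕ) (t : ℝ≥0), 1 ≤ n → 0 < t →
        ‖EulerApprox.eulerError S A n t (x : X)‖
          ≤ 12 * M * ‖S.fracPow α x‖ * ((t : ℝ) / √(n : ℝ)) ^ α) := by
  have hM' : ∀ t, ‖S.T t‖ ≤ M := fun t => hM.1 ⟨t, rfl⟩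
  refine ⟨fun h hh => (EulerApprox.resolventStep_spec hA hh).1, fun f hf =>
    ⟨hf.exists_isHolomorphicExtension, fun F hF => ?_⟩, fun α h0 h2 =>
    ⟨EulerApprox.regularizable_cpow hA h0 h2, fun x n t hn ht =>
      EulerApprox.norm_eulerError_le_fracPow hA hM' h0 h2 x hn ht⟩⟩
  have hreg := hf.regularizable hA hran hF
  refine ⟨hreg, fun x n t hn ht => ?_, fun y n t hn ht => ?_⟩
  · obtain ⟨d, hd, B, hB, hBM⟩ := hf.exists_hasSymbol_eulerError_mul hA hF hM' hn ht
    obtain ⟨hx, he⟩ := (hd.calculus_apply hreg hB).1 x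
    refine ⟨hx, ?_⟩
    rw [he]
    exact (B.le_of_opNorm_le hBM x).trans_eq (by ring)
  · obtain ⟨d, hd, B, hB, hBM⟩ := hf.exists_hasSymbol_eulerError_mul hA hF hM' hn ht
    rw [(hd.calculus_apply hreg hB).2 y]
    exact (B.le_of_opNorm_le hBM _).trans_eq (by ring)
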